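/- Let $n\ge 0$ and $r\ge 2$ be integers, let $B^n$ and $\bar B^n$ be the open and the closed unit ball of $\mathbb{R}^n$, and let $C^r(\bar B^n,\mathbb{R})$ be the separable Banach space of continuous functions on $\bar B^n$ that are $C^r$ on $B^n$ and whose differentials up to order $r$ extend continuously to $\bar B^n$, normed by the sum of the suprema of the differentials of orders $0,\dots,r$. Let $N\subset C^r(\bar B^n,\mathbb{R})$ be the set of functions that are not Morse on $B^n$, that is, that have a critical point $x\in B^n$ at which the second differential is a degenerate bilinear form. (1) If $r\ge 2$, then $N$ is a countable union of closed sets with empty interior, and $N$ is both Haar null and Aronszajn null in $C^r(\bar B^n,\mathbb{R})$. (2) If $r\ge 3$, then $N$ is rectifiable of positive codimension, that is, rectifiable of codimension $d$ for some integer $d\ge 1$. Here a subset $A$ of a separable Banach space $F$ is - *Haar null* if there is a Borel probability measure $\mu$ on $F$ such that, for every $f\in F$, the set $A+f$ is contained in a Borel set of $\mu$-measure zero; - *Aronszajn null* if, for each sequence $(f_k)$ in $F$ whose linear span is dense, there are Borel sets $A_k\subset F$ with $A\subset\bigcup_k A_k$ such that $\{t\in\mathbb{R}: f+tf_k\in A_k\}$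 has Lebesgue measure zero for each $f\in F$ and each $k$; - a *Lipschitz graph of codimension $d$* if there are a topological splitting $F=E\oplus G$ with $\dim G=d$ and a Lipschitz map $g:E\to G$ such that $A\subset\{x+g(x): x\in E\}$; - *rectifiable of codimension $d$* if $A=\bigcup_k\varphi_k(A_k)$ (a countable union), where each $\varphi_k:U_k\to F$ is a $C^1$ map on an open subset $U_k$ of a separable Banach space $F_k$, whose differential at every point of $U_k$ is Fredholm of index $i_k$ (dimension of the kernel minus codimension of the range), and $A_k\subset U_k$ is a Lipschitz graph of codimension $d+i_k$ in $F_k$. -/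

import Mathlib

open Set MeasureTheory Topology

/-! ## The space of functions of class `C^r` on the closed unit ball -/

section CrSpace

/-- The open unit ball `B^n` of Euclidean space. -/
abbrev openUnitBall (n : ℕ) : Set (EuclideanSpace ℝ (Fin n)) := Metric.ball 0 1

/-- The closed unit ball of Euclidean space. -/
abbrev closedUnitBall (n : ℕ) : Set (EuclideanSpace ℝ (Fin n)) := Metric.closedBall 0 1

open Classical in
/-- Extension by zero of a function on the closed ball. It is only used to differentiate at points
of the open ball, where the derivatives do not depend on the values outside the ball. -/
noncomputable def extendZero {n : ℕ} (f : closedUnitBall n → ℝ) :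
    EuclideanSpace ℝ (Fin n) → ℝ :=
  fun x => if h : x ∈ closedUnitBall n then f ⟨x, h⟩ else 0

theorem extendZero_add {n : ℕ} (f g : closedUnitBall n → ℝ) :
    extendZero (f + g) = extendZero f + extendZero g := by
  funext x
  by_cases h : x ∈ closedUnitBall n <;> simp [extendZero, h]

theorem extendZero_smul {n : ℕ} (c : ℝ) (f : closedUnitBall n → ℝ) :
    extendZero (c • f) = c • extendZero f := by
  funext x
  by_cases h : x ∈ closedUnitBall n <;> simp [extendZero, h]

theorem extendZero_zero {n : ℕ} :
    extendZero (0 : closedUnitBall n → ℝ) = 0 := by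
  funext x
  simp [extendZero]

/-- `f` is of class `C^r` up to the boundary: it is continuous on the closed ball, `C^r` on the open
ball, and its differentials of order `≤ r` extend continuously to the closed ball. -/
structure IsCrClosedBall {n : ℕ} (r : ℕ) (f : closedUnitBall n → ℝ) : Prop where
  continuous : Continuous f
  contDiffOn : ContDiffOn ℝ r (extendZero f) (openUnitBall n)
  extend : ∀ k ≤ r, ∃ D : EuclideanSpace ℝ (Fin n) → (EuclideanSpace ℝ (Fin n)) [×k]→L[ℝ] ℝ,
    ContinuousOn D (closedUnitBall n) ∧
      ∀ x ∈ openUnitBall n, D x = iteratedFDeriv ℝ k (extendZero f) x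

theorem IsCrClosedBall.contDiffAt {n r k : ℕ} {f : closedUnitBall n → ℝ}
    (hf : IsCrClosedBall r f) (hk : k ≤ r) {x : EuclideanSpace ℝ (Fin n)}
    (hx : x ∈ openUnitBall n) : ContDiffAt ℝ k (extendZero f) x :=
  (hf.contDiffOn.contDiffAt (Metric.isOpen_ball.mem_nhds hx)).of_le (by exact_mod_cast hk)

theorem IsCrClosedBall.add {n r : ℕ} {f g : closedUnitBall n → ℝ}
    (hf : IsCrClosedBall r f) (hg : IsCrClosedBall r g) : IsCrClosedBall r (f + g) where
  continuous := hf.continuous.add hg.continuous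
  contDiffOn := by
    rw [extendZero_add]
    exact hf.contDiffOn.add hg.contDiffOn
  extend k hk := by
    obtain ⟨D, hD, hD'⟩ := hf.extend k hk
    obtain ⟨D₂, hD₂, hD₂'⟩ := hg.extend k hk
    refine ⟨fun x => D x + D₂ x, hD.add hD₂, fun x hx => ?_⟩
    rw [extendZero_add, iteratedFDeriv_add_apply (hf.contDiffAt hk hx) (hg.contDiffAt hk hx),
      ← hD' x hx, ← hD₂' x hx]

theorem IsCrClosedBall.smul {n r : ℕ} {f : closedUnitBall n → ℝ} (c : ℝ)
    (hf : IsCrClosedBall r f) : IsCrClosedBall r (c • f) where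
  continuous := hf.continuous.const_smul c
  contDiffOn := by
    rw [extendZero_smul]
    exact contDiffOn_const.smul hf.contDiffOn
  extend k hk := by
    obtain ⟨D, hD, hD'⟩ := hf.extend k hk
    refine ⟨fun x => c • D x, hD.const_smul c, fun x hx => ?_⟩
    rw [extendZero_smul, iteratedFDeriv_const_smul_apply (hf.contDiffAt hk hx), ← hD' x hx]

theorem IsCrClosedBall.zero {n r : ℕ} : IsCrClosedBall r (0 : closedUnitBall n → ℝ) where
  continuous := continuous_const
  contDiffOn := by
    rw [extendZero_zero]
    exact contDiffOn_const
  extend k _ := by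
    refine ⟨fun _ => 0, continuousOn_const, fun x _ => ?_⟩
    rw [extendZero_zero, iteratedFDeriv_zero]
    rfl

/-- The functions of class `C^r` on the closed ball, as a linear subspace of all functions. -/
def crSubmodule (n r : ℕ) : Submodule ℝ (closedUnitBall n → ℝ) where
  carrier := {f | IsCrClosedBall r f}
  add_mem' := IsCrClosedBall.add
  zero_mem' := IsCrClosedBall.zero
  smul_mem' := fun c _ hf => hf.smul c

/-- The space of functions of class `C^r` on the closed unit ball of `ℝ^n`. -/
def CrBall (n r : ℕ) : Type := crSubmodule n r

namespace CrBall

variable {n r : ℕ}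

instance : AddCommGroup (CrBall n r) := inferInstanceAs (AddCommGroup (crSubmodule n r))

instance : Module ℝ (CrBall n r) := inferInstanceAs (Module ℝ (crSubmodule n r))

/-- The function on the closed ball underlying an element of `CrBall n r`. -/
def toFun (f : CrBall n r) : closedUnitBall n → ℝ := f.1

/-- An element of `CrBall n r` as a function on `ℝ^n`, equal to zero outside the closed ball. -/
noncomputable def ext0 (f : CrBall n r) : EuclideanSpace ℝ (Fin n) → ℝ := extendZero f.toFun

/-- The norm: the sum, over the orders `0, …, r`, of the suprema over the ball of the norms of
the differentials. -/
noncomputable instance : Norm (CrBall n r) where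
  norm f := ∑ k ∈ Finset.range (r + 1), ⨆ x : openUnitBall n, ‖iteratedFDeriv ℝ k f.ext0 x‖

theorem norm_def (f : CrBall n r) : ‖f‖ =
    ∑ k ∈ Finset.range (r + 1), ⨆ x : openUnitBall n, ‖iteratedFDeriv ℝ k f.ext0 x‖ := rfl

theorem isCr (f : CrBall n r) : IsCrClosedBall r f.toFun := f.2

theorem contDiffAt_ext0 (f : CrBall n r) {k : ℕ} (hk : k ≤ r) {x : EuclideanSpace ℝ (Fin n)}
    (hx : x ∈ openUnitBall n) : ContDiffAt ℝ k f.ext0 x := f.isCr.contDiffAt hk hx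

theorem bddAbove_range (f : CrBall n r) {k : ℕ} (hk : k ≤ r) :
    BddAbove (range fun x : openUnitBall n => ‖iteratedFDeriv ℝ k f.ext0 x‖) := by
  obtain ⟨D, hD, hD'⟩ := f.isCr.extend k hk
  obtain ⟨C, hC⟩ := (isCompact_closedBall (0 : EuclideanSpace ℝ (Fin n)) 1).exists_bound_of_continuousOn hD
  refine ⟨C, ?_⟩
  rintro _ ⟨x, rfl⟩
  have h := hC x (Metric.ball_subset_closedBall x.2)
  rw [hD' x x.2] at h
  exact h

instance : Nonempty (openUnitBall n) := ⟨⟨0, by simp⟩⟩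

theorem ext0_add (f g : CrBall n r) : (f + g).ext0 = f.ext0 + g.ext0 := extendZero_add _ _

theorem ext0_smul (c : ℝ) (f : CrBall n r) : (c • f).ext0 = c • f.ext0 := extendZero_smul _ _

theorem eq_zero_of_norm_eq_zero (f : CrBall n r) (h : ‖f‖ = 0) : f = 0 := by
  have hnn : ∀ k ∈ Finset.range (r + 1),
      0 ≤ ⨆ x : openUnitBall n, ‖iteratedFDeriv ℝ k f.ext0 x‖ :=
    fun k _ => Real.iSup_nonneg fun _ => norm_nonneg _
  rw [norm_def, Finset.sum_eq_zero_iff_of_nonneg hnn] at h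
  have h0 := h 0 (by simp)
  have hb : ∀ x ∈ openUnitBall n, f.ext0 x = 0 := by
    intro x hx
    have h1 := le_ciSup (f.bddAbove_range (Nat.zero_le r)) ⟨x, hx⟩
    rw [h0, norm_iteratedFDeriv_zero] at h1
    exact norm_le_zero_iff.1 h1
  have hcont : ContinuousOn f.ext0 (closedUnitBall n) := by
    rw [continuousOn_iff_continuous_domRestrict]
    have he : (closedUnitBall n).domRestrict f.ext0 = f.toFun := by
      funext x
      exact dif_pos x.2
    rw [he]
    exact f.isCr.continuous
  have hz : EqOn f.ext0 (fun _ => 0) (closedUnitBall n) := by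
    refine EqOn.of_subset_closure (s := openUnitBall n) hb hcont continuousOn_const
      Metric.ball_subset_closedBall ?_
    rw [closure_ball _ one_ne_zero]
  refine Subtype.ext (funext fun x => ?_)
  have hx := hz x.2
  simp only [ext0, extendZero, dif_pos x.2] at hx
  exact hx

theorem normedSpaceCore (n r : ℕ) : NormedSpace.Core ℝ (CrBall n r) where
  norm_nonneg f := Finset.sum_nonneg fun _ _ => Real.iSup_nonneg fun _ => norm_nonneg _
  norm_smul c f := by
    rw [norm_def, norm_def, Finset.mul_sum]
    refine Finset.sum_congr rfl fun k hk => ?_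
    rw [Real.mul_iSup_of_nonneg (norm_nonneg c)]
    refine iSup_congr fun x => ?_
    rw [ext0_smul, iteratedFDeriv_const_smul_apply
      (f.contDiffAt_ext0 (Finset.mem_range_succ_iff.1 hk) x.2), norm_smul]
  norm_triangle f g := by
    rw [norm_def, norm_def, norm_def, ← Finset.sum_add_distrib]
    refine Finset.sum_le_sum fun k hk => ?_
    have hk' := Finset.mem_range_succ_iff.1 hk
    refine ciSup_le fun x => ?_
    rw [ext0_add, iteratedFDeriv_add_apply (f.contDiffAt_ext0 hk' x.2)
      (g.contDiffAt_ext0 hk' x.2)]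
    exact (norm_add_le _ _).trans
      (add_le_add (le_ciSup (f.bddAbove_range hk') x) (le_ciSup (g.bddAbove_range hk') x))
  norm_eq_zero_iff f := by
    refine ⟨eq_zero_of_norm_eq_zero f, ?_⟩
    rintro rfl
    have h : (0 : CrBall n r).ext0 = 0 := extendZero_zero
    rw [norm_def]
    refine Finset.sum_eq_zero fun k _ => ?_
    rw [h, iteratedFDeriv_zero]
    simp

noncomputable instance : NormedAddCommGroup (CrBall n r) :=
  NormedAddCommGroup.ofCore (normedSpaceCore n r)

noncomputable instance : NormedSpace ℝ (CrBall n r) :=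
  NormedSpace.ofCore (normedSpaceCore n r)

/-- `f` is Morse on the open ball: at every critical point in the open ball, the second
differential is a nondegenerate bilinear form. -/
def IsMorse (f : CrBall n r) : Prop :=
  ∀ x ∈ openUnitBall n, fderiv ℝ f.ext0 x = 0 →
    ∀ v, (∀ w, fderiv ℝ (fderiv ℝ f.ext0) x v w = 0) → v = 0

end CrBall

/-- The set of functions of class `C^r` on the closed ball which are not Morse on the open ball. -/
def nonMorse (n r : ℕ) : Set (CrBall n r) := {f | ¬ f.IsMorse}

end CrSpace

/-! ## Small sets in Banach spaces -/

section SmallSets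

/-- Haar null sets. As `μ` is extended to all sets as an outer measure, `μ S = 0` means that `S` is
contained in a Borel set of measure zero. -/
def IsHaarNull {F : Type*} [NormedAddCommGroup F] (A : Set F) : Prop :=
  letI : MeasurableSpace F := borel F
  ∃ μ : Measure F, IsProbabilityMeasure μ ∧ ∀ f : F, μ ((fun x => x + f) '' A) = 0

/-- Aronszajn null sets: for every sequence `u` which generates a dense subspace, `A` is covered by
Borel sets `B k` such that `B k` meets every line of direction `u k` in a set of Lebesgue measure
zero. -/
def IsAronszajnNull {F : Type*} [NormedAddCommGroup F] [NormedSpace ℝ F] (A : Set F) : Prop :=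
  ∀ u : ℕ → F, Dense (Submodule.span ℝ (range u) : Set F) →
    ∃ B : ℕ → Set F, (∀ k, MeasurableSet[borel F] (B k)) ∧ A ⊆ ⋃ k, B k ∧
      ∀ k, ∀ f : F, volume {t : ℝ | f + t • u k ∈ B k} = 0

/-- `A` is a Lipschitz graph of codimension `d`: it is contained in the graph of a Lipschitz map
`E → G`, where `F = E ⊕ G` is a topological splitting with `dim G = d`. (There is none if `d` is
negative.) -/
def IsLipschitzGraph {F : Type*} [NormedAddCommGroup F] [NormedSpace ℝ F] (d : ℤ)
    (A : Set F) : Prop :=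
  ∃ E G : Submodule ℝ F, E.IsTopCompl G ∧ FiniteDimensional ℝ G ∧ (Module.finrank ℝ G : ℤ) = d ∧
    ∃ (K : NNReal) (g : E → G), LipschitzWith K g ∧ A ⊆ {y | ∃ x : E, y = (x : F) + (g x : F)}

/-- A Fredholm operator of index `i`, the index being the dimension of the kernel minus the
codimension of the range. -/
def IsFredholmOfIndex {E F : Type*} [NormedAddCommGroup E] [NormedSpace ℝ E]
    [NormedAddCommGroup F] [NormedSpace ℝ F] (i : ℤ) (L : E →L[ℝ] F) : Prop :=
  L.IsFredholm ∧ (Module.finrank ℝ L.ker : ℤ) - (Module.finrank ℝ (F ⧸ L.range) : ℤ) = i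

/-- `φ` is a Fredholm map of index `i` on the open set `U`: it is `C^1` and all its differentials
are Fredholm of index `i`. -/
def IsFredholmMapOn {E F : Type*} [NormedAddCommGroup E] [NormedSpace ℝ E]
    [NormedAddCommGroup F] [NormedSpace ℝ F] (i : ℤ) (φ : E → F) (U : Set E) : Prop :=
  ContDiffOn ℝ 1 φ U ∧ ∀ x ∈ U, IsFredholmOfIndex i (fderiv ℝ φ x)

/-- `S = φ(B)` for a Fredholm map `φ` of some index `i`, defined on an open subset `U` of a separable
Banach space, and a Lipschitz graph `B ⊆ U` of codimension `d + i`. (Every separable Banach space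
is isomorphic to one in `Type`.) -/
def IsRectifiablePiece {X : Type*} [NormedAddCommGroup X] [NormedSpace ℝ X] (d : ℕ)
    (S : Set X) : Prop :=
  ∃ (E : Type) (_ : NormedAddCommGroup E) (_ : NormedSpace ℝ E) (_ : CompleteSpace E)
    (_ : TopologicalSpace.SeparableSpace E) (i : ℤ) (φ : E → X) (U B : Set E),
    IsOpen U ∧ IsFredholmMapOn i φ U ∧ B ⊆ U ∧ IsLipschitzGraph ((d : ℤ) + i) B ∧ S = φ '' B

/-- `A` is rectifiable of codimension `d`: a countable union of images of Lipschitz graphs under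
Fredholm maps, as above. -/
def IsRectifiable {X : Type*} [NormedAddCommGroup X] [NormedSpace ℝ X] (d : ℕ)
    (A : Set X) : Prop :=
  ∃ S : ℕ → Set X, (∀ k, IsRectifiablePiece d (S k)) ∧ A = ⋃ k, S k

end SmallSets

/-! Smallness of the set of non-Morse functions. Perturb `f` to `f + ∑ tᵢ uᵢ`, where the
differentials of `u₁, …, uₙ` form a basis of the dual at each point of an open set `W`. A point `y ∈
W` is critical for exactly one parameter, `t = τ(y)`, and this critical point is degenerate exactly
when `dτ(y)` is singular. The bad parameters are thus the critical values of a differentiable map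
between spaces of equal dimension, and they form a null set
(`volume_setOf_add_sum_mem_degenerateOn`). With the coordinate functions, `W` is the whole ball;
this gives Haar nullity and empty interior. Closedness over compact sets of critical points follows
by compactness (`isClosed_degenerateOn`). For a sequence with dense span, some `n` of its members
serve as the `uᵢ` near any given point. Countably many such neighbourhoods suffice, and Fubini
splits a set that is null along an `n`-dimensional span into sets null along the individual
directions (`exists_null_along_of_volume_eq_zero`).

Rectifiability. Non-Morse functions are the first components of the triples `(f, x, v)` with `df(x)
= 0`, `d²f(x)v = 0`, `|v|² = 1`. These are `2n + 1` scalar equations. For `r ≥ 3` their left side is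
strictly differentiable with surjective differential, so the triples locally form a Lipschitz graph
of codimension `2n + 1`. Forgetting `(x, v)` is Fredholm of index `2n`, which leaves codimension
`1`. -/

set_option maxSynthPendingDepth 3

/-! ### Differentials as functions of `f`, and closedness of degeneracy over compact sets -/

namespace CrBall

variable {n r : ℕ} {x : EuclideanSpace ℝ (Fin n)}

theorem norm_iteratedFDeriv_le (f : CrBall n r) {k : ℕ} (hk : k ≤ r) (hx : x ∈ openUnitBall n) :
    ‖iteratedFDeriv ℝ k f.ext0 x‖ ≤ ‖f‖ := by
  rw [norm_def]
  refine (le_ciSup (f.bddAbove_range hk) ⟨x, hx⟩).trans ?_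
  exact Finset.single_le_sum
    (f := fun k => ⨆ x : openUnitBall n, ‖iteratedFDeriv ℝ k f.ext0 x‖)
    (fun _ _ => Real.iSup_nonneg fun _ => norm_nonneg _) (Finset.mem_range_succ_iff.2 hk)

theorem norm_fderiv_le (f : CrBall n r) (hr : 1 ≤ r) (hx : x ∈ openUnitBall n) :
    ‖fderiv ℝ f.ext0 x‖ ≤ ‖f‖ := by
  rw [← norm_iteratedFDeriv_one]
  exact f.norm_iteratedFDeriv_le hr hx

theorem norm_fderiv_fderiv_le (f : CrBall n r) (hr : 2 ≤ r) (hx : x ∈ openUnitBall n) :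
    ‖fderiv ℝ (fderiv ℝ f.ext0) x‖ ≤ ‖f‖ := by
  rw [← norm_iteratedFDeriv_one, norm_iteratedFDeriv_fderiv]
  exact f.norm_iteratedFDeriv_le hr hx

theorem norm_fderiv_fderiv_fderiv_le (f : CrBall n r) (hr : 3 ≤ r) (hx : x ∈ openUnitBall n) :
    ‖fderiv ℝ (fderiv ℝ (fderiv ℝ f.ext0)) x‖ ≤ ‖f‖ := by
  rw [← norm_iteratedFDeriv_one, norm_iteratedFDeriv_fderiv, norm_iteratedFDeriv_fderiv]
  exact f.norm_iteratedFDeriv_le hr hx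

theorem contDiffAt_fderiv (f : CrBall n r) {k : ℕ} (hk : k + 1 ≤ r) (hx : x ∈ openUnitBall n) :
    ContDiffAt ℝ k (fderiv ℝ f.ext0) x :=
  (f.contDiffAt_ext0 hk hx).fderiv_right (by norm_cast)

theorem contDiffAt_fderiv_fderiv (f : CrBall n r) {k : ℕ} (hk : k + 2 ≤ r)
    (hx : x ∈ openUnitBall n) : ContDiffAt ℝ k (fderiv ℝ (fderiv ℝ f.ext0)) x :=
  (f.contDiffAt_fderiv (k := k + 1) hk hx).fderiv_right (by norm_cast)

theorem differentiableAt_ext0 (f : CrBall n r) (hr : 1 ≤ r) (hx : x ∈ openUnitBall n) :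
    DifferentiableAt ℝ f.ext0 x :=
  (f.contDiffAt_ext0 hr hx).differentiableAt (by simp)

theorem differentiableAt_fderiv (f : CrBall n r) (hr : 2 ≤ r) (hx : x ∈ openUnitBall n) :
    DifferentiableAt ℝ (fderiv ℝ f.ext0) x :=
  (f.contDiffAt_fderiv (k := 1) hr hx).differentiableAt (by simp)

theorem differentiableAt_fderiv_fderiv (f : CrBall n r) (hr : 3 ≤ r) (hx : x ∈ openUnitBall n) :
    DifferentiableAt ℝ (fderiv ℝ (fderiv ℝ f.ext0)) x :=
  (f.contDiffAt_fderiv_fderiv (k := 1) hr hx).differentiableAt (by simp)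

theorem fderiv_ext0_add (f g : CrBall n r) (hr : 1 ≤ r) (hx : x ∈ openUnitBall n) :
    fderiv ℝ (f + g).ext0 x = fderiv ℝ f.ext0 x + fderiv ℝ g.ext0 x := by
  rw [ext0_add, fderiv_add (f.differentiableAt_ext0 hr hx) (g.differentiableAt_ext0 hr hx)]

theorem fderiv_ext0_smul (c : ℝ) (f : CrBall n r) :
    fderiv ℝ (c • f).ext0 x = c • fderiv ℝ f.ext0 x := by
  rw [ext0_smul, fderiv_const_smul_field, Pi.smul_apply]

theorem fderiv_fderiv_ext0_add (f g : CrBall n r) (hr : 2 ≤ r) (hx : x ∈ openUnitBall n) :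
    fderiv ℝ (fderiv ℝ (f + g).ext0) x =
      fderiv ℝ (fderiv ℝ f.ext0) x + fderiv ℝ (fderiv ℝ g.ext0) x := by
  rw [← fderiv_add (f.differentiableAt_fderiv hr hx) (g.differentiableAt_fderiv hr hx)]
  refine Filter.EventuallyEq.fderiv_eq ?_
  filter_upwards [Metric.isOpen_ball.mem_nhds hx] with y hy
  exact fderiv_ext0_add f g (by omega) hy

theorem fderiv_fderiv_ext0_smul (c : ℝ) (f : CrBall n r) (hr : 2 ≤ r) (hx : x ∈ openUnitBall n) :
    fderiv ℝ (fderiv ℝ (c • f).ext0) x = c • fderiv ℝ (fderiv ℝ f.ext0) x := by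
  have h : fderiv ℝ (c • f).ext0 = c • fderiv ℝ f.ext0 := funext fun y => fderiv_ext0_smul c f
  rw [h]
  exact fderiv_const_smul (f.differentiableAt_fderiv hr hx) c

/-- The differential at a point of the open ball, as a function of `f`. -/
noncomputable def fderivCLM (hr : 1 ≤ r) (hx : x ∈ openUnitBall n) :
    CrBall n r →L[ℝ] EuclideanSpace ℝ (Fin n) →L[ℝ] ℝ :=
  LinearMap.mkContinuous
    { toFun f := fderiv ℝ f.ext0 x
      map_add' f g := fderiv_ext0_add f g hr hx
      map_smul' c f := fderiv_ext0_smul c f } 1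
    fun f => by simpa using f.norm_fderiv_le hr hx

@[simp]
theorem fderivCLM_apply (hr : 1 ≤ r) (hx : x ∈ openUnitBall n) (f : CrBall n r) :
    fderivCLM hr hx f = fderiv ℝ f.ext0 x := rfl

/-- The second differential at a point of the open ball, as a function of `f`. -/
noncomputable def fderiv₂CLM (hr : 2 ≤ r) (hx : x ∈ openUnitBall n) :
    CrBall n r →L[ℝ] EuclideanSpace ℝ (Fin n) →L[ℝ] EuclideanSpace ℝ (Fin n) →L[ℝ] ℝ :=
  LinearMap.mkContinuous
    { toFun f := fderiv ℝ (fderiv ℝ f.ext0) x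
      map_add' f g := fderiv_fderiv_ext0_add f g hr hx
      map_smul' c f := fderiv_fderiv_ext0_smul c f hr hx } 1
    fun f => by simpa using f.norm_fderiv_fderiv_le hr hx

@[simp]
theorem fderiv₂CLM_apply (hr : 2 ≤ r) (hx : x ∈ openUnitBall n) (f : CrBall n r) :
    fderiv₂CLM hr hx f = fderiv ℝ (fderiv ℝ f.ext0) x := rfl

theorem extendZero_restrict_eqOn (g : EuclideanSpace ℝ (Fin n) → ℝ) :
    EqOn (extendZero fun x : closedUnitBall n => g x) g (closedUnitBall n) :=
  fun _ hx => dif_pos hx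

theorem extendZero_restrict_eventuallyEq (g : EuclideanSpace ℝ (Fin n) → ℝ)
    (hx : x ∈ openUnitBall n) : (extendZero fun x : closedUnitBall n => g x) =ᶠ[𝓝 x] g := by
  filter_upwards [Metric.isOpen_ball.mem_nhds hx] with y hy
  exact extendZero_restrict_eqOn g (Metric.ball_subset_closedBall hy)

/-- The restriction to the closed ball of a function of class `C^r` on the whole space. -/
def ofContDiff (g : EuclideanSpace ℝ (Fin n) → ℝ) (hg : ContDiff ℝ r g) : CrBall n r :=
  ⟨fun x => g x, hg.continuous.comp continuous_subtype_val,
    hg.contDiffOn.congr ((extendZero_restrict_eqOn g).mono Metric.ball_subset_closedBall),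
    fun k hk => ⟨iteratedFDeriv ℝ k g,
      (hg.continuous_iteratedFDeriv (by exact_mod_cast hk)).continuousOn,
      fun _ hx => ((extendZero_restrict_eventuallyEq g hx).iteratedFDeriv ℝ k).self_of_nhds.symm⟩⟩

theorem ext0_ofContDiff_eventuallyEq {g : EuclideanSpace ℝ (Fin n) → ℝ} (hg : ContDiff ℝ r g)
    (hx : x ∈ openUnitBall n) : (ofContDiff g hg).ext0 =ᶠ[𝓝 x] g :=
  extendZero_restrict_eventuallyEq g hx

theorem fderiv_ofContDiff {g : EuclideanSpace ℝ (Fin n) → ℝ} (hg : ContDiff ℝ r g)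
    (hx : x ∈ openUnitBall n) : fderiv ℝ (ofContDiff g hg).ext0 x = fderiv ℝ g x :=
  (ext0_ofContDiff_eventuallyEq hg hx).fderiv_eq

theorem fderiv_fderiv_ofContDiff {g : EuclideanSpace ℝ (Fin n) → ℝ} (hg : ContDiff ℝ r g)
    (hx : x ∈ openUnitBall n) :
    fderiv ℝ (fderiv ℝ (ofContDiff g hg).ext0) x = fderiv ℝ (fderiv ℝ g) x :=
  (ext0_ofContDiff_eventuallyEq hg hx).fderiv.fderiv_eq

/-- The functions with a degenerate critical point in `C`. -/
def degenerateOn (r : ℕ) (C : Set (EuclideanSpace ℝ (Fin n))) : Set (CrBall n r) :=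
  {f | ∃ x ∈ C, fderiv ℝ f.ext0 x = 0 ∧
    ∃ v, ‖v‖ = 1 ∧ fderiv ℝ (fderiv ℝ f.ext0) x v = 0}

theorem nonMorse_eq_degenerateOn : nonMorse n r = degenerateOn r (openUnitBall n) := by
  ext f
  simp only [nonMorse, IsMorse, degenerateOn, mem_ofPred_eq, not_forall]
  constructor
  · rintro ⟨x, hx, h, v, hv, hv0⟩
    refine ⟨x, hx, h, ‖v‖⁻¹ • v, norm_smul_inv_norm hv0, ?_⟩
    rw [map_smul, show fderiv ℝ (fderiv ℝ f.ext0) x v = 0 from ContinuousLinearMap.ext hv,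
      smul_zero]
  · rintro ⟨x, hx, h, v, hv, hv0⟩
    refine ⟨x, hx, h, v, fun w => by rw [hv0]; rfl, ?_⟩
    rintro rfl
    simp at hv

theorem degenerateOn_mono {C D : Set (EuclideanSpace ℝ (Fin n))} (h : C ⊆ D) :
    degenerateOn r C ⊆ degenerateOn r D := fun _ ⟨x, hx, h'⟩ => ⟨x, h hx, h'⟩

theorem degenerateOn_iUnion {ι : Sort*} (C : ι → Set (EuclideanSpace ℝ (Fin n))) :
    degenerateOn r (⋃ i, C i) = ⋃ i, degenerateOn r (C i) := by
  ext f
  simp only [degenerateOn, mem_iUnion, mem_ofPred_eq]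
  constructor
  · rintro ⟨x, ⟨i, hi⟩, h⟩
    exact ⟨i, x, hi, h⟩
  · rintro ⟨i, x, hi, h⟩
    exact ⟨x, ⟨i, hi⟩, h⟩

/-- Split `f` as `(f - f₀) + f₀`: the first part is bounded by `‖f - f₀‖` uniformly in the point,
and only the fixed function `f₀` is moved along `x`. -/
theorem continuousAt_fderiv_uncurry (hr : 1 ≤ r) (f₀ : CrBall n r) (hx : x ∈ openUnitBall n) :
    ContinuousAt (fun p : CrBall n r × EuclideanSpace ℝ (Fin n) => fderiv ℝ p.1.ext0 p.2)
      (f₀, x) := by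
  have hc : ContinuousAt (fun p : CrBall n r × EuclideanSpace ℝ (Fin n) => fderiv ℝ f₀.ext0 p.2)
      (f₀, x) :=
    ContinuousAt.comp (f := Prod.snd) (f₀.contDiffAt_fderiv (k := 0) hr hx).continuousAt
      continuousAt_snd
  have h : Filter.Tendsto (fun p : CrBall n r × EuclideanSpace ℝ (Fin n) =>
      fderiv ℝ (p.1 - f₀).ext0 p.2) (𝓝 (f₀, x)) (𝓝 0) := by
    refine squeeze_zero_norm'
      (a := fun p : CrBall n r × EuclideanSpace ℝ (Fin n) => ‖p.1 - f₀‖) ?_ ?_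
    · filter_upwards [continuousAt_snd (Metric.isOpen_ball.mem_nhds hx)] with p hp
      exact norm_fderiv_le _ hr hp
    · exact Continuous.tendsto' (by fun_prop) _ _ (by simp)
  have := h.add hc
  simp only [zero_add] at this
  refine this.congr' ?_
  filter_upwards [continuousAt_snd (Metric.isOpen_ball.mem_nhds hx)] with p hp
  rw [← fderiv_ext0_add _ _ hr hp, sub_add_cancel]

theorem continuousAt_fderiv_fderiv_uncurry (hr : 2 ≤ r) (f₀ : CrBall n r)
    (hx : x ∈ openUnitBall n) :
    ContinuousAt (fun p : CrBall n r × EuclideanSpace ℝ (Fin n) =>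
      fderiv ℝ (fderiv ℝ p.1.ext0) p.2) (f₀, x) := by
  have hc : ContinuousAt (fun p : CrBall n r × EuclideanSpace ℝ (Fin n) =>
      fderiv ℝ (fderiv ℝ f₀.ext0) p.2) (f₀, x) :=
    ContinuousAt.comp (f := Prod.snd) (f₀.contDiffAt_fderiv_fderiv (k := 0) hr hx).continuousAt
      continuousAt_snd
  have h : Filter.Tendsto (fun p : CrBall n r × EuclideanSpace ℝ (Fin n) =>
      fderiv ℝ (fderiv ℝ (p.1 - f₀).ext0) p.2) (𝓝 (f₀, x)) (𝓝 0) := by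
    have hb : ∀ᶠ p : CrBall n r × EuclideanSpace ℝ (Fin n) in 𝓝 (f₀, x),
        ‖fderiv ℝ (fderiv ℝ (p.1 - f₀).ext0) p.2‖ ≤ ‖p.1 - f₀‖ := by
      filter_upwards [continuousAt_snd (Metric.isOpen_ball.mem_nhds hx)] with p hp
      exact norm_fderiv_fderiv_le _ hr hp
    refine squeeze_zero_norm' hb ?_
    exact Continuous.tendsto' (by fun_prop) _ _ (by simp)
  have := h.add hc
  simp only [zero_add] at this
  refine this.congr' ?_
  filter_upwards [continuousAt_snd (Metric.isOpen_ball.mem_nhds hx)] with p hp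
  rw [← fderiv_fderiv_ext0_add _ _ hr hp, sub_add_cancel]

/-- The degeneracy conditions are closed in `(f, x, v)`, and `(x, v)` ranges over the compact set `C
× S`, along which projection is a closed map. -/
theorem isClosed_degenerateOn (hr : 2 ≤ r) {C : Set (EuclideanSpace ℝ (Fin n))}
    (hC : IsCompact C) (hCB : C ⊆ openUnitBall n) : IsClosed (degenerateOn r C) := by
  have : CompactSpace C := isCompact_iff_compactSpace.1 hC
  let S : Set (EuclideanSpace ℝ (Fin n)) := Metric.sphere 0 1
  let Z : Set (CrBall n r × (C × S)) := {p | fderiv ℝ p.1.ext0 p.2.1 = 0 ∧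
    fderiv ℝ (fderiv ℝ p.1.ext0) p.2.1 p.2.2 = 0}
  have hi : Continuous fun p : CrBall n r × (C × S) =>
      (p.1, (p.2.1 : EuclideanSpace ℝ (Fin n))) := by fun_prop
  have h₁ : Continuous fun p : CrBall n r × (C × S) => fderiv ℝ p.1.ext0 p.2.1 :=
    continuous_iff_continuousAt.2 fun p => ContinuousAt.comp (x := p)
      (f := fun p : CrBall n r × (C × S) => (p.1, (p.2.1 : EuclideanSpace ℝ (Fin n))))
      (g := fun p : CrBall n r × EuclideanSpace ℝ (Fin n) => fderiv ℝ p.1.ext0 p.2)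
      (continuousAt_fderiv_uncurry (by omega) p.1 (hCB p.2.1.2)) hi.continuousAt
  have h₂ : Continuous fun p : CrBall n r × (C × S) => fderiv ℝ (fderiv ℝ p.1.ext0) p.2.1 :=
    continuous_iff_continuousAt.2 fun p => ContinuousAt.comp (x := p)
      (f := fun p : CrBall n r × (C × S) => (p.1, (p.2.1 : EuclideanSpace ℝ (Fin n))))
      (g := fun p : CrBall n r × EuclideanSpace ℝ (Fin n) => fderiv ℝ (fderiv ℝ p.1.ext0) p.2)
      (continuousAt_fderiv_fderiv_uncurry hr p.1 (hCB p.2.1.2)) hi.continuousAt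
  have hZ : IsClosed Z := (isClosed_eq h₁ continuous_const).inter
    (isClosed_eq (h₂.clm_apply (by fun_prop)) continuous_const)
  convert isClosedMap_fst_of_compactSpace Z hZ using 1
  ext f
  constructor
  · rintro ⟨x, hx, h, v, hv, hv0⟩
    exact ⟨(f, ⟨x, hx⟩, ⟨v, by simpa [S] using hv⟩), ⟨h, hv0⟩, rfl⟩
  · rintro ⟨⟨g, x, v⟩, ⟨h, h'⟩, rfl⟩
    exact ⟨x, x.2, h, v, mem_sphere_zero_iff_norm.1 v.2, h'⟩

theorem openUnitBall_eq_iUnion_closedBall : openUnitBall n =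
    ⋃ k : ℕ, Metric.closedBall (0 : EuclideanSpace ℝ (Fin n)) (1 - 1 / ((k : ℝ) + 1)) := by
  ext x
  simp only [Metric.mem_ball, mem_iUnion, Metric.mem_closedBall]
  constructor
  · intro hx
    obtain ⟨k, hk⟩ := exists_nat_one_div_lt (sub_pos.2 hx)
    exact ⟨k, by linarith⟩
  · rintro ⟨k, hk⟩
    have : 0 < 1 / ((k : ℝ) + 1) := by positivity
    linarith

end CrBall

/-- The witnessing measure is Lebesgue measure on the unit cube, pushed forward by `t ↦ ∑ tᵢ uᵢ`. -/
theorem isHaarNull_of_volume_eq_zero {F : Type*} [NormedAddCommGroup F] [NormedSpace ℝ F]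
    {A : Set F} (hA : MeasurableSet[borel F] A) {m : ℕ} (u : Fin m → F)
    (h : ∀ f, volume {t : Fin m → ℝ | f + ∑ i, t i • u i ∈ A} = 0) : IsHaarNull A := by
  unfold IsHaarNull
  let : MeasurableSpace F := borel F
  have : BorelSpace F := ⟨rfl⟩
  have hT : Continuous fun t : Fin m → ℝ => ∑ i, t i • u i := by fun_prop
  have hp : IsProbabilityMeasure ((volume : Measure (Fin m → ℝ)).restrict (Icc 0 1)) :=
    ⟨by simp [Real.volume_Icc_pi]⟩
  refine ⟨((volume : Measure (Fin m → ℝ)).restrict (Icc 0 1)).map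
    fun t => ∑ i, t i • u i, Measure.isProbabilityMeasure_map hT.measurable.aemeasurable,
    fun f => ?_⟩
  have hm : MeasurableSet ((fun x => x + f) '' A) :=
    (Homeomorph.addRight f).measurableEmbedding.measurableSet_image.2 hA
  rw [Measure.map_apply hT.measurable hm]
  refine Measure.restrict_le_self.absolutelyContinuous (measure_mono_null ?_ (h (-f)))
  rintro t ⟨g, hg, hgt⟩
  replace hgt : g + f = ∑ i, t i • u i := hgt
  have : -f + ∑ i, t i • u i = g := by
    rw [← hgt]
    abel
  rw [mem_ofPred_eq, this]
  exact hg

/-! ### Sard's theorem for finite-dimensional perturbations; Haar nullity -/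

namespace CrBall

variable {n r : ℕ} {x : EuclideanSpace ℝ (Fin n)}

/-- The linear combinations of the differentials at `x` of a family of functions. -/
noncomputable def sumFDeriv (u : Fin n → CrBall n r) (x : EuclideanSpace ℝ (Fin n)) :
    (Fin n → ℝ) →L[ℝ] EuclideanSpace ℝ (Fin n) →L[ℝ] ℝ :=
  ∑ i, (ContinuousLinearMap.proj (R := ℝ) (φ := fun _ : Fin n => ℝ) i).smulRight
    (fderiv ℝ (u i).ext0 x)

theorem sumFDeriv_apply (u : Fin n → CrBall n r) (x : EuclideanSpace ℝ (Fin n)) (t : Fin n → ℝ) :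
    sumFDeriv u x t = ∑ i, t i • fderiv ℝ (u i).ext0 x := by
  simp [sumFDeriv]

theorem fderiv_add_sum (hr : 1 ≤ r) (f : CrBall n r) (u : Fin n → CrBall n r) (t : Fin n → ℝ)
    (hx : x ∈ openUnitBall n) :
    fderiv ℝ (f + ∑ i, t i • u i).ext0 x = fderiv ℝ f.ext0 x + sumFDeriv u x t := by
  have h := map_add (fderivCLM hr hx) f (∑ i, t i • u i)
  rw [map_sum] at h
  simpa only [map_smul, fderivCLM_apply, ← sumFDeriv_apply] using h

theorem differentiableAt_sumFDeriv (hr : 2 ≤ r) (u : Fin n → CrBall n r)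
    (hx : x ∈ openUnitBall n) : DifferentiableAt ℝ (sumFDeriv u) x := by
  unfold sumFDeriv
  refine DifferentiableAt.fun_sum fun i _ => ?_
  exact (ContinuousLinearMap.smulRightL ℝ (Fin n → ℝ) (EuclideanSpace ℝ (Fin n) →L[ℝ] ℝ)
    (ContinuousLinearMap.proj i)).differentiableAt.comp x ((u i).differentiableAt_fderiv hr hx)

theorem sumFDeriv_injective {u : Fin n → CrBall n r}
    (hu : LinearIndependent ℝ fun i => fderiv ℝ (u i).ext0 x) :
    Function.Injective (sumFDeriv u x) := by
  rw [injective_iff_map_eq_zero]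
  intro t ht
  rw [sumFDeriv_apply] at ht
  exact funext (Fintype.linearIndependent_iff.1 hu t ht)

theorem finrank_dual_euclideanSpace (n : ℕ) :
    Module.finrank ℝ (EuclideanSpace ℝ (Fin n) →L[ℝ] ℝ) = n := by
  rw [← (LinearMap.toContinuousLinearMap (𝕜 := ℝ) (E := EuclideanSpace ℝ (Fin n))
    (F' := ℝ)).finrank_eq, Module.finrank_linearMap]
  simp

theorem sumFDeriv_isInvertible {u : Fin n → CrBall n r}
    (hu : LinearIndependent ℝ fun i => fderiv ℝ (u i).ext0 x) :
    (sumFDeriv u x).IsInvertible := by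
  have hd : Module.finrank ℝ (Fin n → ℝ) =
      Module.finrank ℝ (EuclideanSpace ℝ (Fin n) →L[ℝ] ℝ) := by
    rw [finrank_dual_euclideanSpace]
    simp
  exact ⟨(LinearMap.linearEquivOfInjective (sumFDeriv u x : (Fin n → ℝ) →ₗ[ℝ] _)
    (sumFDeriv_injective hu) hd).toContinuousLinearEquiv, by ext; rfl⟩

/-- A form of Sard's theorem: if the differentials of `u₁, …, uₙ` are independent at every point of
`W`, then `f + ∑ i, t i • u i` has no degenerate critical point in `W`, for almost every `t`. -/
theorem volume_setOf_add_sum_mem_degenerateOn (hr : 2 ≤ r) (u : Fin n → CrBall n r)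
    {W : Set (EuclideanSpace ℝ (Fin n))} (hWo : IsOpen W) (hW : W ⊆ openUnitBall n)
    (hu : ∀ x ∈ W, LinearIndependent ℝ fun i => fderiv ℝ (u i).ext0 x) (f : CrBall n r) :
    volume {t : Fin n → ℝ | f + ∑ i, t i • u i ∈ degenerateOn r W} = 0 := by
  let e : (Fin n → ℝ) ≃L[ℝ] EuclideanSpace ℝ (Fin n) := (EuclideanSpace.equiv (Fin n) ℝ).symm
  -- `τ y` is the only parameter `t` for which `y ∈ W` is a critical point of `f + ∑ tᵢ uᵢ`.
  let τ : EuclideanSpace ℝ (Fin n) → Fin n → ℝ :=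
    fun y => -((sumFDeriv u y).inverse (fderiv ℝ f.ext0 y))
  have hLτ : ∀ y ∈ W, sumFDeriv u y (τ y) = -fderiv ℝ f.ext0 y := by
    intro y hy
    simp only [τ, map_neg]
    rw [(sumFDeriv_isInvertible (hu y hy)).self_apply_inverse]
  have hτ : ∀ y ∈ W, DifferentiableAt ℝ τ y := by
    intro y hy
    have h₁ : DifferentiableAt ℝ (fun z => (sumFDeriv u z).inverse) y :=
      (((sumFDeriv_isInvertible (hu y hy)).contDiffAt_map_inverse (n := 1)).differentiableAt
        (by simp)).comp y (differentiableAt_sumFDeriv hr u (hW hy))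
    exact (h₁.clm_apply (f.differentiableAt_fderiv hr (hW hy))).neg
  have hd : ∀ y ∈ W, ∀ v, fderiv ℝ (fderiv ℝ (f + ∑ i, τ y i • u i).ext0) y v =
      -sumFDeriv u y (fderiv ℝ τ y v) := by
    intro y hy v
    -- The parameter is frozen at `τ y`. In the product rule at `z = y`, the term differentiating
    -- `sumFDeriv u z` is applied to `τ y - τ y = 0` and drops out.
    have h₁ : fderiv ℝ (f + ∑ i, τ y i • u i).ext0 =ᶠ[𝓝 y]
        fun z => sumFDeriv u z (τ y - τ z) := by
      filter_upwards [hWo.mem_nhds hy] with z hz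
      rw [fderiv_add_sum (by omega) f u _ (hW hz), map_sub, hLτ z hz]
      abel
    have h₂ := (differentiableAt_sumFDeriv hr u (hW hy)).hasFDerivAt.clm_apply
      ((hτ y hy).hasFDerivAt.const_sub (τ y))
    rw [h₁.fderiv_eq, h₂.fderiv]
    simp
  -- The critical points of `τ`, read through `e` so that `τ ∘ e` maps a space to itself and has a
  -- determinant.
  let s : Set (Fin n → ℝ) := {y | e y ∈ W ∧ ∃ v, v ≠ 0 ∧ fderiv ℝ τ (e y) v = 0}
  have hs : volume ((τ ∘ e) '' s) = 0 := by
    refine addHaar_image_eq_zero_of_det_fderivWithin_eq_zero volume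
      (f' := fun y => (fderiv ℝ τ (e y)).comp (e : (Fin n → ℝ) →L[ℝ] EuclideanSpace ℝ (Fin n)))
      (fun y hy => ?_) fun y hy => ?_
    · exact ((hτ _ hy.1).hasFDerivAt.comp y e.hasFDerivAt).hasFDerivWithinAt
    · obtain ⟨-, v, hv, hv0⟩ := hy
      by_contra hdet
      have hi := (LinearMap.equivOfDetNeZero _ hdet).injective
      refine hv (e.symm.map_eq_zero_iff.1 (hi ?_))
      rw [map_zero]
      change fderiv ℝ τ (e y) (e (e.symm v)) = 0
      rw [e.apply_symm_apply, hv0]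
  refine measure_mono_null ?_ hs
  rintro t ⟨x, hx, hc, v, hv, hv0⟩
  have ht : t = τ x := by
    refine sumFDeriv_injective (hu x hx) ?_
    rw [hLτ x hx, eq_neg_iff_add_eq_zero, add_comm, ← fderiv_add_sum (by omega) f u t (hW hx), hc]
  subst ht
  refine ⟨e.symm x, ⟨by simpa using hx, v, ?_, ?_⟩, by simp⟩
  · rintro rfl
    simp at hv
  · rw [hd x hx, neg_eq_zero] at hv0
    rw [e.apply_symm_apply]
    exact sumFDeriv_injective (hu x hx) (by rw [hv0, map_zero])

/-- The coordinate functions. -/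
noncomputable def coord (r : ℕ) (i : Fin n) : CrBall n r :=
  ofContDiff (EuclideanSpace.proj i : EuclideanSpace ℝ (Fin n) →L[ℝ] ℝ)
    (ContinuousLinearMap.contDiff _)

theorem linearIndependent_fderiv_coord (hx : x ∈ openUnitBall n) :
    LinearIndependent ℝ fun i => fderiv ℝ (coord r i).ext0 x := by
  rw [Fintype.linearIndependent_iff]
  intro t ht i
  have h := congrArg (fun L => L (EuclideanSpace.single i 1)) ht
  simp only [coord, fderiv_ofContDiff _ hx, ContinuousLinearMap.fderiv] at h
  simpa using h

theorem volume_setOf_add_sum_coord_mem_nonMorse (hr : 2 ≤ r) (f : CrBall n r) :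
    volume {t : Fin n → ℝ | f + ∑ i, t i • coord r i ∈ nonMorse n r} = 0 := by
  rw [nonMorse_eq_degenerateOn]
  exact volume_setOf_add_sum_mem_degenerateOn hr _ Metric.isOpen_ball Subset.rfl
    (fun _ hx => linearIndependent_fderiv_coord hx) f

/-- Around an interior point `f`, the parameters keeping `f + ∑ tᵢ xᵢ` in the interior would form a
nonempty open set, of positive measure. -/
theorem interior_eq_empty_of_subset_nonMorse (hr : 2 ≤ r) {K : Set (CrBall n r)}
    (hK : K ⊆ nonMorse n r) : interior K = ∅ := by
  by_contra h
  obtain ⟨f, hf⟩ := nonempty_iff_ne_empty.2 h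
  have hc : Continuous fun t : Fin n → ℝ => f + ∑ i, t i • coord r i := by fun_prop
  have ho := (isOpen_interior (s := K)).preimage hc
  refine (ho.measure_pos volume ⟨0, by simpa using hf⟩).ne' (measure_mono_null ?_
    (volume_setOf_add_sum_coord_mem_nonMorse hr f))
  exact fun t ht => hK (interior_subset ht)

theorem nonMorse_eq_iUnion_isClosed (hr : 2 ≤ r) : ∃ K : ℕ → Set (CrBall n r),
    (∀ k, IsClosed (K k) ∧ interior (K k) = ∅) ∧ nonMorse n r = ⋃ k, K k := by
  have hsub : ∀ k : ℕ, Metric.closedBall (0 : EuclideanSpace ℝ (Fin n)) (1 - 1 / ((k : ℝ) + 1)) ⊆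
      openUnitBall n := fun k => by
    rw [openUnitBall_eq_iUnion_closedBall]
    exact subset_iUnion 
      (fun k : ℕ => Metric.closedBall (0 : EuclideanSpace ℝ (Fin n)) (1 - 1 / ((k : ℝ) + 1))) k
  refine ⟨fun k => degenerateOn r (Metric.closedBall 0 (1 - 1 / ((k : ℝ) + 1))), fun k =>
    ⟨isClosed_degenerateOn hr (isCompact_closedBall _ _) (hsub k),
      interior_eq_empty_of_subset_nonMorse hr ?_⟩, ?_⟩
  · rw [nonMorse_eq_degenerateOn]
    exact degenerateOn_mono (hsub k)
  · rw [nonMorse_eq_degenerateOn, openUnitBall_eq_iUnion_closedBall, degenerateOn_iUnion]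

theorem isHaarNull_nonMorse (hr : 2 ≤ r) : IsHaarNull (nonMorse n r) := by
  obtain ⟨K, hK, hN⟩ := nonMorse_eq_iUnion_isClosed (n := n) hr
  refine isHaarNull_of_volume_eq_zero ?_ (coord r) (volume_setOf_add_sum_coord_mem_nonMorse hr)
  borelize (CrBall n r)
  rw [hN]
  exact MeasurableSet.iUnion fun k => (hK k).1.measurableSet

end CrBall

/-! ### Fubini decomposition into directions -/

/-- A Borel set which meets all translates of the span of `e₁, …, eₘ` in null sets is a union of
Borel sets which are null in the directions `e₁, …, eₘ` respectively. -/
theorem exists_null_along_of_volume_eq_zero {F : Type*} [NormedAddCommGroup F] [NormedSpace ℝ F]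
    {m : ℕ} (e : Fin m → F) {A : Set F} (hA : MeasurableSet[borel F] A)
    (h : ∀ f, volume {t : Fin m → ℝ | f + ∑ i, t i • e i ∈ A} = 0) :
    ∃ B : Fin m → Set F, (∀ i, MeasurableSet[borel F] (B i)) ∧ A ⊆ ⋃ i, B i ∧
      ∀ i, ∀ f : F, volume {t : ℝ | f + t • e i ∈ B i} = 0 := by
  borelize F
  induction m generalizing A with
  | zero =>
    -- The volume of the one-point parameter space is positive, so `A` must be empty.
    refine ⟨fun _ => ∅, fun _ => MeasurableSet.empty, fun f hf => ?_, fun i => i.elim0⟩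
    have h' := h f
    simp only [Finset.univ_eq_empty, Finset.sum_empty, add_zero, hf] at h'
    exact absurd h' (isOpen_univ.measure_pos volume univ_nonempty).ne'
  | succ m ih =>
    let T : (Fin m → ℝ) → F := fun t => ∑ i, t i • e i.succ
    have hT : Continuous T := by fun_prop
    -- `g f` measures the slice of `A` through `f` along the last `m` directions. The part of `A`
    -- where `g = 0` is left to induction; the part where `g ≠ 0` will be null along `e 0`.
    let g : F → ENNReal := fun f => volume {t : Fin m → ℝ | f + T t ∈ A}
    have hg : Measurable g := by
      have hc : Continuous fun p : F × (Fin m → ℝ) => p.1 + T p.2 := by fun_prop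
      exact measurable_measure_prodMk_left (hc.measurable hA)
    -- Since `g` is constant along these directions, a slice of `A ∩ {g = 0}` is either a full null
    -- slice of `A` or empty.
    have hgT : ∀ f t, g (f + T t) = g f := by
      intro f t
      have hadd : ∀ s, f + T t + T s = f + T (t + s) := fun s => by
        simp only [T, Pi.add_apply, add_smul, Finset.sum_add_distrib]
        abel
      simp only [g, hadd]
      exact measure_preimage_add volume t {s | f + T s ∈ A}
    obtain ⟨B, hB, hAB, hB0⟩ := ih (fun i => e i.succ) (A := A ∩ {f | g f = 0})
      (hA.inter (hg (measurableSet_singleton 0))) fun f => by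
        by_cases hf : g f = 0
        · exact measure_mono_null (fun t ht => ht.1) hf
        · convert measure_empty (μ := (volume : Measure (Fin m → ℝ)))
          refine eq_empty_of_forall_notMem fun t ht => hf ?_
          rw [← hgT f t]
          exact ht.2
    refine ⟨Fin.cons (A ∩ {f | g f ≠ 0}) B, fun i => ?_, fun f hf => ?_, fun i => ?_⟩
    · refine Fin.cases ?_ (fun i => ?_) i
      · exact hA.inter (hg (measurableSet_singleton 0)).compl
      · exact hB i
    · rw [mem_iUnion]
      by_cases hgf : g f = 0
      · obtain ⟨i, hi⟩ := mem_iUnion.1 (hAB ⟨hf, hgf⟩)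
        exact ⟨i.succ, hi⟩
      · exact ⟨0, hf, hgf⟩
    · refine Fin.cases (fun f => ?_) (fun i => ?_) i
      · have hc : Continuous fun p : ℝ × (Fin m → ℝ) => f + p.1 • e 0 + T p.2 := by fun_prop
        have hm : MeasurableSet {p : ℝ × (Fin m → ℝ) | f + p.1 • e 0 + T p.2 ∈ A} :=
          hc.measurable hA
        have h0 : volume {p : ℝ × (Fin m → ℝ) | f + p.1 • e 0 + T p.2 ∈ A} = 0 := by
          rw [← h f, ← (volume_preserving_piFinSuccAbove (fun _ : Fin (m + 1) => ℝ)
            0).measure_preimage hm.nullMeasurableSet]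
          congr 1
          ext t
          simp [Fin.sum_univ_succ, T, add_assoc, Fin.tail]
        -- Fubini: on each line of direction `e 0`, almost every point satisfies `g = 0`.
        rw [Measure.volume_eq_prod, Measure.measure_prod_null hm] at h0
        refine measure_mono_null ?_ (ae_iff.1 h0)
        rintro t ⟨-, ht⟩
        exact ht
      · exact hB0 i

/-! ### Aronszajn nullity -/

namespace CrBall

variable {n r : ℕ} {x : EuclideanSpace ℝ (Fin n)}

theorem exists_fderiv_eq (hx : x ∈ openUnitBall n) (L : EuclideanSpace ℝ (Fin n) →L[ℝ] ℝ) :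
    ∃ f : CrBall n r, fderiv ℝ f.ext0 x = L :=
  ⟨ofContDiff L L.contDiff, by rw [fderiv_ofContDiff _ hx, L.fderiv]⟩

/-- The differential at `x` maps onto the dual, so a dense span has dense image there. A dense
subspace in finite dimension is everything, and a basis can be extracted from the spanning family.
-/
theorem exists_linearIndependent_fderiv (hr : 1 ≤ r) {u : ℕ → CrBall n r}
    (hu : Dense (Submodule.span ℝ (range u) : Set (CrBall n r))) (hx : x ∈ openUnitBall n) :
    ∃ j : Fin n → ℕ, LinearIndependent ℝ fun i => fderiv ℝ (u (j i)).ext0 x := by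
  have hs : Function.Surjective (fderivCLM (r := r) hr hx) := fun L => exists_fderiv_eq hx L
  have hd : Dense (Submodule.span ℝ (range fun k => fderiv ℝ (u k).ext0 x) :
      Set (EuclideanSpace ℝ (Fin n) →L[ℝ] ℝ)) := by
    have h := hs.denseRange.dense_image (fderivCLM (r := r) hr hx).continuous hu
    have h' : fderivCLM (r := r) hr hx '' (Submodule.span ℝ (range u) : Set (CrBall n r)) =
        Submodule.span ℝ (range fun k => fderiv ℝ (u k).ext0 x) := by
      have := Submodule.map_span (fderivCLM (r := r) hr hx).toLinearMap (range u)
      rw [← range_comp] at this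
      exact congrArg (fun S : Submodule ℝ (EuclideanSpace ℝ (Fin n) →L[ℝ] ℝ) =>
        (S : Set (EuclideanSpace ℝ (Fin n) →L[ℝ] ℝ))) this
    rwa [h'] at h
  have ht : Submodule.span ℝ (range fun k => fderiv ℝ (u k).ext0 x) = ⊤ := by
    rw [← SetLike.coe_set_eq, Submodule.top_coe, ← hd.closure_eq]
    exact (Submodule.closed_of_finiteDimensional _).closure_eq.symm
  obtain ⟨v, hv, -, hli⟩ := Submodule.exists_fun_fin_finrank_span_eq ℝ
    (range fun k => fderiv ℝ (u k).ext0 x)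
  have hn : Module.finrank ℝ (Submodule.span ℝ (range fun k => fderiv ℝ (u k).ext0 x)) = n := by
    rw [ht, finrank_top, finrank_dual_euclideanSpace]
  choose j hj using hv
  refine ⟨fun i => j (Fin.cast hn.symm i), ?_⟩
  simp only [hj]
  exact hli.comp _ (Fin.cast_injective _)

theorem exists_ball_linearIndependent_fderiv (hr : 2 ≤ r) (v : Fin n → CrBall n r)
    (hx : x ∈ openUnitBall n) (hv : LinearIndependent ℝ fun i => fderiv ℝ (v i).ext0 x) :
    ∃ ε > 0, Metric.ball x ε ⊆ openUnitBall n ∧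
      ∀ y ∈ Metric.ball x ε, LinearIndependent ℝ fun i => fderiv ℝ (v i).ext0 y := by
  have hc : ContinuousAt (fun y i => fderiv ℝ (v i).ext0 y) x :=
    continuousAt_pi.2 fun i => ((v i).differentiableAt_fderiv hr hx).continuousAt
  have h := (hc.eventually (isOpen_setOfPred_linearIndependent.mem_nhds hv)).and
    (Metric.isOpen_ball.mem_nhds hx)
  obtain ⟨ε, hε, h⟩ := Metric.eventually_nhds_iff_ball.1 h
  exact ⟨ε, hε, fun y hy => (h y hy).2, fun y hy => (h y hy).1⟩

theorem isAronszajnNull_nonMorse (hr : 2 ≤ r) : IsAronszajnNull (nonMorse n r) := by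
  intro u hu
  choose j hj using fun x : openUnitBall n =>
    exists_linearIndependent_fderiv (by omega) hu x.2
  choose ε hε hεB hεl using fun x : openUnitBall n =>
    exists_ball_linearIndependent_fderiv hr _ x.2 (hj x)
  -- The Sard argument works on the open balls of radius `ε x`; the closed balls of half the radius
  -- are compact, which makes the corresponding sets of functions closed, hence Borel.
  have hCW : ∀ x : openUnitBall n, Metric.closedBall (x : EuclideanSpace ℝ (Fin n)) (ε x / 2) ⊆
      Metric.ball x (ε x) := fun x : openUnitBall n => Metric.closedBall_subset_ball (half_lt_self (hε x))
  obtain ⟨t, ht, hcov⟩ := TopologicalSpace.countable_cover_nhds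
    (f := fun x : openUnitBall n => Subtype.val ⁻¹' Metric.closedBall
      (x : EuclideanSpace ℝ (Fin n)) (ε x / 2)) fun x : openUnitBall n =>
    continuousAt_subtype_val (Metric.closedBall_mem_nhds _ (half_pos (hε x)))
  have hA : ∀ x : openUnitBall n, ∃ B : Fin n → Set (CrBall n r),
      (∀ i, MeasurableSet[borel _] (B i)) ∧
      degenerateOn r (Metric.closedBall (x : EuclideanSpace ℝ (Fin n)) (ε x / 2)) ⊆ ⋃ i, B i ∧
      ∀ i, ∀ f, volume {t : ℝ | f + t • u (j x i) ∈ B i} = 0 := by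
    intro x
    refine exists_null_along_of_volume_eq_zero _ ?_ fun f => measure_mono_null ?_
      (volume_setOf_add_sum_mem_degenerateOn hr _ Metric.isOpen_ball (hεB x) (hεl x) f)
    · borelize (CrBall n r)
      exact (isClosed_degenerateOn hr (isCompact_closedBall _ _)
        ((hCW x).trans (hεB x))).measurableSet
    · exact fun t ht => degenerateOn_mono (hCW x) ht
  choose B hBm hAB hB0 using hA
  -- All pieces that are null in direction `u k`, whatever ball they come from, are collected under
  -- the index `k`.
  refine ⟨fun k => ⋃ x ∈ t, ⋃ (i) (_ : j x i = k), B x i, fun k => ?_, fun f hf => ?_,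
    fun k f => ?_⟩
  · borelize (CrBall n r)
    exact MeasurableSet.biUnion ht fun x _ => MeasurableSet.iUnion fun i =>
      MeasurableSet.iUnion fun _ => hBm x i
  · rw [nonMorse_eq_degenerateOn] at hf
    obtain ⟨y, hy, hfy⟩ := hf
    have hy' : (⟨y, hy⟩ : openUnitBall n) ∈ ⋃ x ∈ t, Subtype.val ⁻¹' Metric.closedBall
      (x : EuclideanSpace ℝ (Fin n)) (ε x / 2) := hcov ▸ mem_univ _
    simp only [mem_iUnion] at hy'
    obtain ⟨x, hxt, hyx⟩ := hy'
    obtain ⟨i, hi⟩ := mem_iUnion.1 (hAB x ⟨y, hyx, hfy⟩)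
    simp only [mem_iUnion]
    exact ⟨j x i, x, hxt, i, rfl, hi⟩
  · have : {s : ℝ | f + s • u k ∈ ⋃ x ∈ t, ⋃ (i) (_ : j x i = k), B x i} =
        ⋃ x ∈ t, ⋃ (i) (_ : j x i = k), {s : ℝ | f + s • u k ∈ B x i} := by
      ext s
      simp only [mem_ofPred_eq, mem_iUnion]
    rw [this, measure_biUnion_null_iff ht]
    intro x _
    rw [measure_iUnion_null_iff]
    intro i
    rw [measure_iUnion_null_iff]
    rintro rfl
    exact hB0 x i f

end CrBall

/-! ### Separability and completeness of `CrBall n r` -/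

namespace CrBall

variable {n r : ℕ} {x : EuclideanSpace ℝ (Fin n)}

theorem exists_continuousMap_eq_iteratedFDeriv (f : CrBall n r) {k : ℕ} (hk : k ≤ r) :
    ∃ D : C(closedUnitBall n, (EuclideanSpace ℝ (Fin n)) [×k]→L[ℝ] ℝ),
      ∀ x (hx : x ∈ openUnitBall n), D ⟨x, Metric.ball_subset_closedBall hx⟩ =
        iteratedFDeriv ℝ k f.ext0 x := by
  obtain ⟨D, hD, hD'⟩ := f.isCr.extend k hk
  exact ⟨⟨fun x => D x, continuousOn_iff_continuous_domRestrict.1 hD⟩, hD'⟩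

open Classical in
/-- The differential of order `k ≤ r`, continuously extended to the closed ball. -/
noncomputable def jet (f : CrBall n r) (k : ℕ) :
    C(closedUnitBall n, (EuclideanSpace ℝ (Fin n)) [×k]→L[ℝ] ℝ) :=
  if hk : k ≤ r then (f.exists_continuousMap_eq_iteratedFDeriv hk).choose else 0

theorem jet_apply (f : CrBall n r) {k : ℕ} (hk : k ≤ r) (hx : x ∈ openUnitBall n) :
    f.jet k ⟨x, Metric.ball_subset_closedBall hx⟩ = iteratedFDeriv ℝ k f.ext0 x := by
  rw [jet, dif_pos hk]
  exact (f.exists_continuousMap_eq_iteratedFDeriv hk).choose_spec x hx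

theorem dense_openUnitBall_preimage (n : ℕ) :
    Dense {x : closedUnitBall n | (x : EuclideanSpace ℝ (Fin n)) ∈ openUnitBall n} := by
  intro x
  rw [closure_subtype]
  have h : (x : EuclideanSpace ℝ (Fin n)) ∈ closure (openUnitBall n) := by
    rw [closure_ball _ one_ne_zero]
    exact x.2
  convert h using 2
  ext y
  constructor
  · rintro ⟨z, hz, rfl⟩
    exact hz
  · exact fun hy => ⟨⟨y, Metric.ball_subset_closedBall hy⟩, hy, rfl⟩

theorem iteratedFDeriv_ext0_sub (f g : CrBall n r) {k : ℕ} (hk : k ≤ r)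
    (hx : x ∈ openUnitBall n) : iteratedFDeriv ℝ k (f - g).ext0 x =
      iteratedFDeriv ℝ k f.ext0 x - iteratedFDeriv ℝ k g.ext0 x := by
  rw [eq_sub_iff_add_eq, ← iteratedFDeriv_add_apply ((f - g).contDiffAt_ext0 hk hx)
    (g.contDiffAt_ext0 hk hx), ← ext0_add, sub_add_cancel]

theorem norm_jet_sub_le (f g : CrBall n r) (k : ℕ) : ‖f.jet k - g.jet k‖ ≤ ‖f - g‖ := by
  by_cases hk : k ≤ r
  · rw [ContinuousMap.norm_le _ (norm_nonneg _)]
    refine (dense_openUnitBall_preimage n).induction ?_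
      (isClosed_le (f.jet k - g.jet k).continuous.norm continuous_const)
    intro x hx
    have := (f - g).norm_iteratedFDeriv_le hk hx
    rwa [iteratedFDeriv_ext0_sub f g hk hx, ← jet_apply f hk hx, ← jet_apply g hk hx] at this
  · simp [jet, hk]

theorem norm_le_sum (f : CrBall n r) (c : ℕ → ℝ)
    (h : ∀ k ≤ r, ∀ x ∈ openUnitBall n, ‖iteratedFDeriv ℝ k f.ext0 x‖ ≤ c k) :
    ‖f‖ ≤ ∑ k ∈ Finset.range (r + 1), c k := by
  rw [norm_def]
  exact Finset.sum_le_sum fun k hk =>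
    ciSup_le fun x => h k (Finset.mem_range_succ_iff.1 hk) x x.2

instance (k : ℕ) : FiniteDimensional ℝ ((EuclideanSpace ℝ (Fin n)) [×k]→L[ℝ] ℝ) :=
  Module.Finite.of_injective
    ContinuousMultilinearMap.toMultilinearMapLinear
    ContinuousMultilinearMap.toMultilinearMap_injective

/-- The jets embed the space bi-Lipschitzly in a finite product of spaces of continuous maps from a
compact metric space to finite-dimensional spaces. That product is second countable, a property
inherited by subspaces. -/
instance : TopologicalSpace.SeparableSpace (CrBall n r) := by
  let J : CrBall n r → ∀ k : Fin (r + 1),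
    C(closedUnitBall n, (EuclideanSpace ℝ (Fin n)) [×(k : ℕ)]→L[ℝ] ℝ) := fun f k => f.jet k
  have hl : LipschitzWith 1 J := LipschitzWith.of_dist_le_mul fun f g => by
    rw [NNReal.coe_one, one_mul, dist_pi_le_iff dist_nonneg]
    intro k
    rw [dist_eq_norm, dist_eq_norm]
    exact norm_jet_sub_le f g k
  have ha : AntilipschitzWith (r + 1 : ℕ) J := AntilipschitzWith.of_le_mul_dist fun f g => by
    rw [dist_eq_norm]
    refine (norm_le_sum (f - g) (fun _ => dist (J f) (J g)) fun k hk x hx => ?_).trans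
      (by simp)
    rw [iteratedFDeriv_ext0_sub f g hk hx, ← jet_apply f hk hx, ← jet_apply g hk hx,
      ← dist_eq_norm]
    exact (ContinuousMap.dist_apply_le_dist _).trans
      (dist_le_pi_dist (J f) (J g) ⟨k, Nat.lt_succ_of_le hk⟩)
  have hs : ∀ k : ℕ, SecondCountableTopology ((EuclideanSpace ℝ (Fin n)) [×k]→L[ℝ] ℝ) :=
    fun k => by
      have := FiniteDimensional.proper ℝ ((EuclideanSpace ℝ (Fin n)) [×k]→L[ℝ] ℝ)
      infer_instance
  have := (ha.isUniformInducing hl.uniformContinuous).isInducing.secondCountableTopology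
  infer_instance

/-- A uniform limit on the closed ball of the differentials of a sequence in `CrBall n r` comes
from an element of `CrBall n r`. -/
theorem exists_iteratedFDeriv_eq_of_tendsto (f : ℕ → CrBall n r)
    (P : ∀ k : ℕ, C(closedUnitBall n, (EuclideanSpace ℝ (Fin n)) [×k]→L[ℝ] ℝ))
    (hP : ∀ k, Filter.Tendsto (fun m => (f m).jet k) Filter.atTop (𝓝 (P k))) :
    ∃ g : CrBall n r, ∀ k ≤ r, ∀ x (hx : x ∈ openUnitBall n),
      iteratedFDeriv ℝ k g.ext0 x = P k ⟨x, Metric.ball_subset_closedBall hx⟩ := by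
  classical
  let p : EuclideanSpace ℝ (Fin n) → FormalMultilinearSeries ℝ (EuclideanSpace ℝ (Fin n)) ℝ :=
    fun x k => if h : x ∈ closedUnitBall n then P k ⟨x, h⟩ else 0
  have hp : ∀ k x (h : x ∈ closedUnitBall n), p x k = P k ⟨x, h⟩ := fun k x h => dif_pos h
  have hpc : ∀ k, ContinuousOn (fun x => p x k) (closedUnitBall n) := by
    intro k
    rw [continuousOn_iff_continuous_domRestrict]
    refine (P k).continuous.congr fun x => ?_
    exact (hp k x x.2).symm
  have hlim : ∀ k, TendstoUniformly (fun m => ⇑((f m).jet k)) (P k) Filter.atTop :=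
    fun k => ContinuousMap.tendsto_iff_tendstoUniformly.1 (hP k)
  let φ : closedUnitBall n → ℝ := fun x => P 0 x 0
  have hT : HasFTaylorSeriesUpToOn r (extendZero φ) p (openUnitBall n) := by
    refine ⟨fun x hx => ?_, fun m hm x hx => ?_,
      fun m _ => (hpc m).mono Metric.ball_subset_closedBall⟩
    · have hx' := Metric.ball_subset_closedBall hx
      rw [hp 0 x hx', extendZero, dif_pos hx']
      rfl
    · have hm' : m + 1 ≤ r := by exact_mod_cast hm
      refine HasFDerivAt.hasFDerivWithinAt ?_
      -- Uniform convergence of the differentials of order `m + 1` identifies `p · (m + 1)` as the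
      -- derivative of the limit of order `m`.
      refine hasFDerivAt_of_tendstoUniformlyOn (l := Filter.atTop)
        (f := fun i => iteratedFDeriv ℝ m (f i).ext0)
        (f' := fun i y => (iteratedFDeriv ℝ (m + 1) (f i).ext0 y).curryLeft)
        (g' := fun y => (p y m.succ).curryLeft) (s := openUnitBall n)
        Metric.isOpen_ball ?_ ?_ ?_ hx
      · rw [Metric.tendstoUniformlyOn_iff]
        intro ε hε
        filter_upwards [Metric.tendstoUniformly_iff.1 (hlim (m + 1)) ε hε] with i hi y hy
        have h := hi ⟨y, Metric.ball_subset_closedBall hy⟩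
        rw [jet_apply _ hm' hy] at h
        rw [hp _ y (Metric.ball_subset_closedBall hy)]
        exact ((continuousMultilinearCurryLeftEquiv ℝ
          (fun _ : Fin (m + 1) => EuclideanSpace ℝ (Fin n)) ℝ).dist_map _ _).trans_lt h
      · intro i y hy
        have hd := ((f i).contDiffAt_ext0 hm' hy).differentiableAt_iteratedFDeriv
          (m := m) (by exact_mod_cast Nat.lt_succ_self m)
        have h := hd.hasFDerivAt
        rw [fderiv_iteratedFDeriv] at h
        exact h
      · intro y hy
        have h := (hlim m).tendsto_at ⟨y, Metric.ball_subset_closedBall hy⟩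
        rw [hp m y (Metric.ball_subset_closedBall hy)]
        refine h.congr fun i => ?_
        rw [jet_apply _ (by omega) hy]
  have heq : ∀ k ≤ r, ∀ x ∈ openUnitBall n, p x k = iteratedFDeriv ℝ k (extendZero φ) x := by
    intro k hk x hx
    rw [hT.eq_iteratedFDerivWithin_of_uniqueDiffOn (by exact_mod_cast hk)
      Metric.isOpen_ball.uniqueDiffOn hx, iteratedFDerivWithin_of_isOpen k Metric.isOpen_ball hx]
  have hφ : IsCrClosedBall r φ :=
    ⟨(ContinuousMultilinearMap.apply ℝ _ ℝ 0).continuous.comp (P 0).continuous,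
      hT.contDiffOn, fun k hk => ⟨fun x => p x k, hpc k, heq k hk⟩⟩
  refine ⟨⟨φ, hφ⟩, fun k hk x hx => ?_⟩
  rw [← hp k x]
  exact (heq k hk x hx).symm

/-- The jets of a Cauchy sequence converge uniformly, their limits are the differentials of one
function, and the norm is at most the sum of the uniform distances of the jets. -/
instance : CompleteSpace (CrBall n r) := by
  refine Metric.complete_of_cauchySeq_tendsto fun f hf => ?_
  have hJ : ∀ k, ∃ P, Filter.Tendsto (fun m => (f m).jet k) Filter.atTop (𝓝 P) := by
    intro k
    refine cauchySeq_tendsto_of_complete (Metric.cauchySeq_iff.2 fun ε hε => ?_)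
    obtain ⟨N, hN⟩ := Metric.cauchySeq_iff.1 hf ε hε
    refine ⟨N, fun i hi j hj => ?_⟩
    rw [dist_eq_norm]
    refine (norm_jet_sub_le _ _ k).trans_lt ?_
    rw [← dist_eq_norm]
    exact hN i hi j hj
  choose P hP using hJ
  obtain ⟨g, hg⟩ := exists_iteratedFDeriv_eq_of_tendsto f P hP
  refine ⟨g, ?_⟩
  rw [tendsto_iff_norm_sub_tendsto_zero]
  refine squeeze_zero (fun _ => norm_nonneg _)
    (fun m => norm_le_sum (f m - g) (fun k => ‖(f m).jet k - P k‖) fun k hk x hx => ?_) ?_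
  · rw [iteratedFDeriv_ext0_sub _ _ hk hx, hg k hk x hx, ← jet_apply _ hk hx]
    exact ContinuousMap.norm_coe_le_norm ((f m).jet k - P k) _
  · have := tendsto_finsetSum (Finset.range (r + 1)) fun k _ =>
      tendsto_iff_norm_sub_tendsto_zero.1 (hP k)
    simpa using this

end CrBall

/-! ### Level sets of submersions as Lipschitz graphs -/

section LipschitzGraph

variable {E Y : Type*} [NormedAddCommGroup E] [NormedSpace ℝ E] [NormedAddCommGroup Y]
  [NormedSpace ℝ Y]

/-- A set on which the projection along `G` is controlled by the projection to the complement is a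
Lipschitz graph. -/
theorem isLipschitzGraph_of_norm_projection_le {K G : Submodule ℝ E} (h : K.IsTopCompl G)
    [FiniteDimensional ℝ G] {S : Set E} (hS : ∀ y ∈ S, ∀ z ∈ S,
      ‖G.projectionOntoL K h.symm (y - z)‖ ≤ ‖K.projectionOntoL G h (y - z)‖) :
    IsLipschitzGraph (Module.finrank ℝ G) S := by
  set πK := K.projectionOntoL G h
  set πG := G.projectionOntoL K h.symm
  have hinv : ∀ k ∈ πK '' S, Function.invFunOn πK S k ∈ S ∧ πK (Function.invFunOn πK S k) = k :=
    fun k hk => Function.invFunOn_pos hk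
  have hl : LipschitzOnWith 1 (fun k => πG (Function.invFunOn πK S k)) (πK '' S) := by
    refine LipschitzOnWith.of_dist_le_mul fun k hk l hl => ?_
    have := hS _ (hinv k hk).1 _ (hinv l hl).1
    rw [map_sub, map_sub, (hinv k hk).2, (hinv l hl).2] at this
    rw [NNReal.coe_one, one_mul, dist_eq_norm, dist_eq_norm]
    exact this
  -- Finite dimension of `G` allows the Lipschitz extension from the projection of `S` to all of
  -- `K`, at the price of a larger constant.
  obtain ⟨g, hg, hgS⟩ := hl.extend_finite_dimension
  refine ⟨K, G, h, inferInstance, rfl, _, g, hg, fun y hy => ⟨πK y, ?_⟩⟩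
  have hk : πK y ∈ πK '' S := mem_image_of_mem _ hy
  -- The hypothesis makes `πK` injective on `S`, so the chosen preimage of `πK y` has the same
  -- `G`-component as `y`.
  have hy' : πG (Function.invFunOn πK S (πK y)) = πG y := by
    have := hS _ (hinv _ hk).1 _ hy
    rw [map_sub πK, (hinv _ hk).2, sub_self, norm_zero, norm_le_zero_iff, map_sub,
      sub_eq_zero] at this
    exact this
  rw [← hgS hk]
  simp only [hy']
  have := congrArg (fun L : E →L[ℝ] E => L y) (Submodule.projectionL_add_projectionL_eq_id h)
  exact this.symm

theorem IsLipschitzGraph.mono {d : ℤ} {S T : Set E} (hT : IsLipschitzGraph d T) (h : S ⊆ T) :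
    IsLipschitzGraph d S := by
  obtain ⟨K, G, hc, hf, hd, C, g, hg, hS⟩ := hT
  exact ⟨K, G, hc, hf, hd, C, g, hg, h.trans hS⟩

/-- Near a point where `ψ` is strictly differentiable with surjective differential, its level set is
a Lipschitz graph. -/
theorem HasStrictFDerivAt.exists_isLipschitzGraph [FiniteDimensional ℝ Y] {ψ : E → Y}
    {L : E →L[ℝ] Y} {p : E} (h : HasStrictFDerivAt ψ L p) (hL : Function.Surjective L) (c : Y) :
    ∃ U ∈ 𝓝 p, IsLipschitzGraph (Module.finrank ℝ Y) (U ∩ ψ ⁻¹' {c}) := by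
  have hq : FiniteDimensional ℝ (E ⧸ L.ker) :=
    Module.Finite.equiv (L.toLinearMap.quotKerEquivOfSurjective hL).symm
  obtain ⟨G, hG⟩ := (Submodule.ClosedComplemented.of_finiteDimensional_quotient
    (p := L.ker) L.isClosed_ker).exists_isTopCompl
  set K := L.ker
  have hLK : ∀ k : K, L k = 0 := fun k => k.2
  have hdec : ∀ y, (K.projectionOntoL G hG y : E) + G.projectionOntoL K hG.symm y = y := fun y =>
    congrArg (fun L : E →L[ℝ] E => L y) (Submodule.projectionL_add_projectionL_eq_id hG)
  have hLd : ∀ y, L (G.projectionOntoL K hG.symm y) = L y := fun y => by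
    conv_rhs => rw [← hdec y, map_add, hLK, zero_add]
  have hbij : Function.Bijective (L.toLinearMap ∘ₗ G.subtype) := by
    refine ⟨(injective_iff_map_eq_zero _).2 fun z hz => ?_, fun y => ?_⟩
    · have hz' : (z : E) ∈ K := hz
      have := hG.isCompl.disjoint.le_bot ⟨hz', z.2⟩
      exact Subtype.ext this
    · obtain ⟨z, rfl⟩ := hL y
      exact ⟨G.projectionOntoL K hG.symm z, hLd z⟩
  let e : G ≃ₗ[ℝ] Y := LinearEquiv.ofBijective _ hbij
  have hGf : FiniteDimensional ℝ G := Module.Finite.equiv e.symm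
  let eL : G ≃L[ℝ] Y := e.toContinuousLinearEquiv
  have heL : ∀ z : G, eL z = L z := fun z => rfl
  -- `L` restricts to an isomorphism of `G` onto `Y`; `C` bounds its inverse, the added `1` keeping
  -- it positive.
  let C : ℝ := ‖(eL.symm : Y →L[ℝ] G)‖ + 1
  have hC : 0 < C := by positivity
  have hCz : ∀ z : G, ‖z‖ ≤ C * ‖L z‖ := fun z => by
    have := (eL.symm : Y →L[ℝ] G).le_opNorm (eL z)
    rw [ContinuousLinearEquiv.coe_coe, eL.symm_apply_apply, heL] at this
    refine this.trans (mul_le_mul_of_nonneg_right ?_ (norm_nonneg _))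
    exact (lt_add_one _).le
  -- On a level set, `‖L (y - z)‖ ≤ ε ‖y - z‖`. With `ε = 1 / (2C)` the `G`-component of `y - z` is
  -- at most half of `‖y - z‖`, hence at most the `K`-component.
  let ε : NNReal := ⟨(2 * C)⁻¹, by positivity⟩
  have hε : 0 < ε := NNReal.coe_pos.1 (by positivity : (0 : ℝ) < (2 * C)⁻¹)
  obtain ⟨U, hU, hUa⟩ := h.approximates_deriv_on_nhds (.inr hε)
  refine ⟨U, hU, ?_⟩
  rw [← e.finrank_eq]
  refine isLipschitzGraph_of_norm_projection_le hG fun y hy z hz => ?_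
  have h₁ := hUa y hy.1 z hz.1
  rw [show ψ y = c from hy.2, show ψ z = c from hz.2, sub_self, zero_sub, norm_neg] at h₁
  have h₁ : ‖L (y - z)‖ ≤ (2 * C)⁻¹ * ‖y - z‖ := h₁
  have h₂ := hCz (G.projectionOntoL K hG.symm (y - z))
  rw [hLd] at h₂
  have h₃ : ‖y - z‖ ≤ ‖K.projectionOntoL G hG (y - z)‖ + ‖G.projectionOntoL K hG.symm (y - z)‖ := by
    conv_lhs => rw [← hdec (y - z)]
    exact norm_add_le _ _
  have h₄ : C * ‖L (y - z)‖ ≤ 2⁻¹ * ‖y - z‖ := by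
    refine (mul_le_mul_of_nonneg_left h₁ hC.le).trans (le_of_eq ?_)
    field_simp
  linarith

end LipschitzGraph

/-! ### Rectifiability of projections -/

section Rectifiable

variable {X : Type*} [NormedAddCommGroup X] [NormedSpace ℝ X]

theorem isFredholmOfIndex_fst {F V : Type*} [NormedAddCommGroup F] [NormedSpace ℝ F]
    [NormedAddCommGroup V] [NormedSpace ℝ V] [FiniteDimensional ℝ V] :
    IsFredholmOfIndex (Module.finrank ℝ V) (ContinuousLinearMap.fst ℝ F V) := by
  have hr : (ContinuousLinearMap.fst ℝ F V).range = ⊤ :=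
    LinearMap.range_eq_top.2 Prod.fst_surjective
  have hk : (ContinuousLinearMap.fst ℝ F V).ker = LinearMap.range (LinearMap.inr ℝ F V) :=
    LinearMap.ker_fst ℝ F V
  refine ⟨⟨?_, ?_, ?_, ?_, ?_⟩, ?_⟩
  · exact isOpenMap_fst.isStrictMap continuous_fst
  · rw [hr]
    exact isClosed_univ
  · rw [hk]
    infer_instance
  · rw [hr]
    exact Submodule.CoFG.top
  · exact ContinuousLinearMap.closedComplemented_ker_of_rightInverse _
      (ContinuousLinearMap.inl ℝ F V) fun _ => rfl
  · rw [hk, LinearMap.finrank_range_of_inj LinearMap.inr_injective, hr]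
    have : Subsingleton (F ⧸ (⊤ : Submodule ℝ F)) := Submodule.Quotient.subsingleton_iff.2 rfl
    simp [Module.finrank_zero_of_subsingleton]

/-- Pads countable families, possibly finite or empty, to sequences. -/
theorem isRectifiablePiece_one_empty : IsRectifiablePiece 1 (∅ : Set X) := by
  refine ⟨ℝ, inferInstance, inferInstance, inferInstance, inferInstance, 0, 0, ∅, ∅, isOpen_empty,
    ⟨contDiffOn_const, by simp⟩, Subset.rfl, ?_, by simp⟩
  exact ⟨⊥, ⊤, Submodule.isTopCompl_bot_top, inferInstance, by simp, 0, 0,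
    LipschitzWith.const 0, empty_subset _⟩

theorem isRectifiable_one_of_countable {ι : Type*} [Countable ι] {S : ι → Set X}
    (hS : ∀ i, IsRectifiablePiece 1 (S i)) : IsRectifiable 1 (⋃ i, S i) := by
  obtain ⟨e, he⟩ := exists_surjective_nat (Option ι)
  have hS' : ∀ o : Option ι, IsRectifiablePiece 1 (o.elim ∅ S) := by
    rintro (- | i)
    · exact isRectifiablePiece_one_empty
    · exact hS i
  refine ⟨fun k => (e k).elim ∅ S, fun k => hS' (e k), ?_⟩
  · rw [he.iUnion_comp fun i : Option ι => i.elim ∅ S]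
    ext y
    simp [iUnion_option]

/-- The projection to `F` of a part of `F × V` which is locally a level set of a submersion with
values in a space of dimension `dim V + 1`. -/
theorem isRectifiable_one_image_fst {F V : Type} [NormedAddCommGroup F] [NormedSpace ℝ F]
    [CompleteSpace F] [TopologicalSpace.SeparableSpace F] [NormedAddCommGroup V] [NormedSpace ℝ V]
    [FiniteDimensional ℝ V] {Z : Set (F × V)}
    (hZ : ∀ p ∈ Z, ∃ U ∈ 𝓝 p, IsLipschitzGraph (Module.finrank ℝ V + 1) (U ∩ Z)) :
    IsRectifiable 1 (Prod.fst '' Z) := by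
  have := FiniteDimensional.complete ℝ V
  have := FiniteDimensional.proper ℝ V
  have : SecondCountableTopology F := UniformSpace.secondCountable_of_separable F
  choose! U hU hUZ using hZ
  obtain ⟨t, htZ, ht, hcov⟩ := TopologicalSpace.countable_cover_nhdsWithin
    fun p hp => mem_nhdsWithin_of_mem_nhds (hU p hp)
  have hc : Countable t := ht
  have : Prod.fst '' Z = ⋃ p : t, Prod.fst '' (U p ∩ Z) := by
    rw [← image_iUnion, ← iUnion_inter]
    congr 1
    refine (inter_eq_right.2 ?_).symm
    rwa [iUnion_subtype]
  rw [this]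
  refine isRectifiable_one_of_countable fun p => ?_
  refine ⟨F × V, inferInstance, inferInstance, inferInstance, inferInstance, Module.finrank ℝ V,
    Prod.fst, univ, U p ∩ Z, isOpen_univ, ⟨contDiff_fst.contDiffOn, fun x _ => ?_⟩, subset_univ _,
    ?_, rfl⟩
  · rw [fderiv_fst]
    exact isFredholmOfIndex_fst
  -- The projection has index `dim V`, so the required codimension `d + i` with `d = 1` is `dim V +
  -- 1`.
  · rw [Nat.cast_one, add_comm]
    exact hUZ p (htZ p.2)

end Rectifiable

/-! ### Strict differentiability of evaluation, and the degenerate triples -/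

/-- Strict differentiability of an evaluation map `(f, x) ↦ A f x` which is linear in `f`. -/
theorem hasStrictFDerivAt_uncurry {F X V : Type*} [NormedAddCommGroup F] [NormedSpace ℝ F]
    [NormedAddCommGroup X] [NormedSpace ℝ X] [NormedAddCommGroup V] [NormedSpace ℝ V]
    {A : F → X → V} {Ω : Set X} (hΩ : IsOpen Ω) (hΩc : Convex ℝ Ω)
    (hsub : ∀ f g, ∀ x ∈ Ω, A (f - g) x = A f x - A g x)
    (hdiff : ∀ f, ∀ x ∈ Ω, DifferentiableAt ℝ (A f) x)
    (hbound : ∀ f, ∀ x ∈ Ω, ‖fderiv ℝ (A f) x‖ ≤ ‖f‖) {f₀ : F} {x₀ : X} (hx₀ : x₀ ∈ Ω)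
    {T : F →L[ℝ] V} (hT : ∀ f, T f = A f x₀) {D : X →L[ℝ] V}
    (hD : HasStrictFDerivAt (A f₀) D x₀) :
    HasStrictFDerivAt (fun p : F × X => A p.1 p.2) (T.coprod D) (f₀, x₀) := by
  refine .of_isLittleO (Asymptotics.isLittleO_iff.2 fun c hc => ?_)
  -- Mean value inequality on the convex set `Ω`: `A f` is Lipschitz there with constant `‖f‖`.
  have hlip : ∀ f, ∀ x ∈ Ω, ∀ y ∈ Ω, ‖A f x - A f y‖ ≤ ‖f‖ * ‖x - y‖ := fun f x hx y hy =>
    hΩc.norm_image_sub_le_of_norm_fderiv_le (hdiff f) (hbound f) hy hx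
  have hc3 : 0 < c / 3 := by positivity
  have t₁ : Filter.Tendsto (fun p : (F × X) × F × X => (p.1.2, p.2.2)) (𝓝 ((f₀, x₀), (f₀, x₀)))
      (𝓝 (x₀, x₀)) := Continuous.tendsto' (by fun_prop) _ _ rfl
  have t₂ : Filter.Tendsto (fun p : (F × X) × F × X => ‖p.1.2 - x₀‖) (𝓝 ((f₀, x₀), (f₀, x₀)))
      (𝓝 0) := Continuous.tendsto' (by fun_prop) _ _ (by simp)
  have t₃ : Filter.Tendsto (fun p : (F × X) × F × X => ‖p.2.1 - f₀‖) (𝓝 ((f₀, x₀), (f₀, x₀)))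
      (𝓝 0) := Continuous.tendsto' (by fun_prop) _ _ (by simp)
  filter_upwards [t₁.eventually (Asymptotics.isLittleO_iff.1 hD.isLittleO hc3),
    t₁.eventually ((hΩ.prod hΩ).mem_nhds ⟨hx₀, hx₀⟩), t₂.eventually_le_const hc3,
    t₃.eventually_le_const hc3]
  rintro ⟨⟨f, x⟩, g, y⟩ h₁ ⟨hx, hy⟩ h₂ h₃
  simp only at h₁ h₂ h₃ hx hy
  have hf : ‖f - g‖ ≤ ‖(f, x) - (g, y)‖ := norm_fst_le ((f, x) - (g, y))
  have hxy : ‖x - y‖ ≤ ‖(f, x) - (g, y)‖ := norm_snd_le ((f, x) - (g, y))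
  -- The three terms are at most `‖f - g‖ ‖x - x₀‖`, `‖g - f₀‖ ‖x - y‖`, and the error in the strict
  -- differentiability of `A f₀`; near the base point each is within `c / 3` of the increment.
  have heq : A f x - A g y - T.coprod D ((f, x) - (g, y)) =
      (A (f - g) x - A (f - g) x₀) + (A (g - f₀) x - A (g - f₀) y) +
        (A f₀ x - A f₀ y - D (x - y)) := by
    rw [Prod.mk_sub_mk, ContinuousLinearMap.coprod_apply, hT, hsub f g x hx, hsub g f₀ x hx,
      hsub g f₀ y hy]
    abel
  simp only [heq]
  have b₁ := (hlip (f - g) x hx x₀ hx₀).trans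
    (mul_le_mul hf h₂ (norm_nonneg _) (norm_nonneg _))
  have b₂ := (hlip (g - f₀) x hx y hy).trans (mul_le_mul h₃ hxy (norm_nonneg _) hc3.le)
  have b₃ := h₁.trans (mul_le_mul_of_nonneg_left hxy hc3.le)
  refine norm_add₃_le.trans ?_
  linarith

namespace CrBall

variable {n r : ℕ} {x : EuclideanSpace ℝ (Fin n)}

theorem hasStrictFDerivAt_fderiv_uncurry (hr : 2 ≤ r) (f : CrBall n r) (hx : x ∈ openUnitBall n) :
    HasStrictFDerivAt (fun p : CrBall n r × EuclideanSpace ℝ (Fin n) => fderiv ℝ p.1.ext0 p.2)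
      ((fderivCLM (by omega) hx).coprod (fderiv ℝ (fderiv ℝ f.ext0) x)) (f, x) := by
  refine hasStrictFDerivAt_uncurry (A := fun f : CrBall n r => fderiv ℝ f.ext0)
    Metric.isOpen_ball (convex_ball _ _)
    (fun f g y hy => map_sub (fderivCLM (r := r) (by omega) hy) f g)
    (fun f y hy => f.differentiableAt_fderiv hr hy)
    (fun f y hy => f.norm_fderiv_fderiv_le hr hy) hx (fun _ => rfl) ?_
  exact (f.contDiffAt_fderiv (k := 1) hr hx).hasStrictFDerivAt (by simp)

/-- Moving `x` differentiates the second differential once more; this is where `r ≥ 3` enters. -/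
theorem hasStrictFDerivAt_fderiv_fderiv_uncurry (hr : 3 ≤ r) (f : CrBall n r)
    (hx : x ∈ openUnitBall n) :
    HasStrictFDerivAt
      (fun p : CrBall n r × EuclideanSpace ℝ (Fin n) => fderiv ℝ (fderiv ℝ p.1.ext0) p.2)
      ((fderiv₂CLM (by omega) hx).coprod (fderiv ℝ (fderiv ℝ (fderiv ℝ f.ext0)) x)) (f, x) := by
  refine hasStrictFDerivAt_uncurry (A := fun f : CrBall n r => fderiv ℝ (fderiv ℝ f.ext0))
    Metric.isOpen_ball (convex_ball _ _)
    (fun f g y hy => map_sub (fderiv₂CLM (r := r) (by omega) hy) f g)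
    (fun f y hy => f.differentiableAt_fderiv_fderiv hr hy)
    (fun f y hy => f.norm_fderiv_fderiv_fderiv_le hr hy) hx (fun _ => rfl) ?_
  exact (f.contDiffAt_fderiv_fderiv (k := 1) hr hx).hasStrictFDerivAt (by simp)

/-- The first differential at `x`, and the second differential in a given direction, may be
prescribed. -/
theorem exists_fderiv_eq_and_fderiv_fderiv_eq (hx : x ∈ openUnitBall n)
    {v : EuclideanSpace ℝ (Fin n)} (hv : ‖v‖ = 1) (α β : EuclideanSpace ℝ (Fin n) →L[ℝ] ℝ) :
    ∃ g : CrBall n r, fderiv ℝ g.ext0 x = α ∧ fderiv ℝ (fderiv ℝ g.ext0) x v = β := by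
  let γ : EuclideanSpace ℝ (Fin n) →L[ℝ] ℝ := innerSL ℝ v
  have hγ : γ v = 1 := by simp [γ, hv]
  -- The second differential of `q` is the symmetric form `β ⊗ γ + γ ⊗ β - β(v) γ ⊗ γ`. Since `γ v =
  -- 1`, contracting it with `v` gives `β`; the last term cancels the surplus `β(v) γ`.
  let q : EuclideanSpace ℝ (Fin n) → ℝ := fun y =>
    α (y - x) + β (y - x) * γ (y - x) - β v / 2 * γ (y - x) ^ 2
  have hq : ContDiff ℝ r q := by fun_prop
  have hd : ∀ y, HasFDerivAt q (α + (β (y - x) • γ + γ (y - x) • β) -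
      (β v * γ (y - x)) • γ) y := by
    intro y
    have h : ∀ L : EuclideanSpace ℝ (Fin n) →L[ℝ] ℝ, HasFDerivAt (fun y => L (y - x)) L y :=
      fun L => L.hasFDerivAt.comp y ((hasFDerivAt_id y).sub_const x)
    refine (((h α).add ((h β).mul (h γ))).sub
      (((h γ).pow 2).const_mul (β v / 2))).congr_fderiv ?_
    ext w
    simp
    ring
  have hd₂ : HasFDerivAt (fun y => α + (β (y - x) • γ + γ (y - x) • β) - (β v * γ (y - x)) • γ)
      (β.smulRight γ + γ.smulRight β - (β v • γ).smulRight γ) x := by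
    have h : ∀ L M : EuclideanSpace ℝ (Fin n) →L[ℝ] ℝ,
        HasFDerivAt (fun y => L (y - x) • M) (L.smulRight M) x := fun L M =>
      (L.smulRight M).hasFDerivAt.comp x ((hasFDerivAt_id x).sub_const x)
    exact (((h β γ).add (h γ β)).const_add α).sub (h (β v • γ) γ)
  refine ⟨ofContDiff q hq, ?_, ?_⟩
  · rw [fderiv_ofContDiff hq hx, (hd x).fderiv]
    simp
  · rw [fderiv_fderiv_ofContDiff hq hx, funext fun y => (hd y).fderiv, hd₂.fderiv]
    ext w
    simp [hγ]

/-- The triples `(f, x, v)` with `v` a unit vector in the kernel of the second differential of `f`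
at the critical point `x`. -/
def degenerateTriples (n r : ℕ) :
    Set (CrBall n r × EuclideanSpace ℝ (Fin n) × EuclideanSpace ℝ (Fin n)) :=
  {p | p.2.1 ∈ openUnitBall n ∧ (fderiv ℝ p.1.ext0 p.2.1,
    fderiv ℝ (fderiv ℝ p.1.ext0) p.2.1 p.2.2, ‖p.2.2‖ ^ 2) = (0, 0, (1 : ℝ))}

theorem nonMorse_eq_image_fst : nonMorse n r = Prod.fst '' degenerateTriples n r := by
  rw [nonMorse_eq_degenerateOn]
  ext f
  constructor
  · rintro ⟨x, hx, h, v, hv, hv0⟩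
    exact ⟨(f, x, v), ⟨hx, by simp [h, hv0, hv]⟩, rfl⟩
  · rintro ⟨⟨g, x, v⟩, ⟨hx, h⟩, rfl⟩
    simp only [Prod.mk.injEq] at h
    exact ⟨x, hx, h.1, v, (pow_eq_one_iff_of_nonneg (norm_nonneg v) two_ne_zero).1 h.2.2, h.2.1⟩

theorem exists_isLipschitzGraph_degenerateTriples (hr : 3 ≤ r)
    {p : CrBall n r × EuclideanSpace ℝ (Fin n) × EuclideanSpace ℝ (Fin n)}
    (hp : p ∈ degenerateTriples n r) : ∃ U ∈ 𝓝 p, IsLipschitzGraph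
      (Module.finrank ℝ (EuclideanSpace ℝ (Fin n) × EuclideanSpace ℝ (Fin n)) + 1)
      (U ∩ degenerateTriples n r) := by
  obtain ⟨f, x, v⟩ := p
  obtain ⟨hx, h⟩ := hp
  simp only [Prod.mk.injEq] at hx h
  obtain ⟨-, hv0, hv⟩ := h
  have hv1 : ‖v‖ = 1 := (pow_eq_one_iff_of_nonneg (norm_nonneg v) two_ne_zero).1 hv
  let V := EuclideanSpace ℝ (Fin n)
  let π : (CrBall n r × V × V) →L[ℝ] CrBall n r × V :=
    (ContinuousLinearMap.fst ℝ (CrBall n r) (V × V)).prod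
      ((ContinuousLinearMap.fst ℝ V V).comp (ContinuousLinearMap.snd ℝ (CrBall n r) (V × V)))
  let ρ : (CrBall n r × V × V) →L[ℝ] V :=
    (ContinuousLinearMap.snd ℝ V V).comp (ContinuousLinearMap.snd ℝ (CrBall n r) (V × V))
  have hπ : HasStrictFDerivAt π π (f, x, v) := π.hasStrictFDerivAt
  have hρ : HasStrictFDerivAt ρ ρ (f, x, v) := ρ.hasStrictFDerivAt
  have h₁ := HasStrictFDerivAt.comp (f := π) (f, x, v)
    (hasStrictFDerivAt_fderiv_uncurry (by omega) f hx) hπ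
  have h₂ := (HasStrictFDerivAt.comp (f := π) (f, x, v)
    (hasStrictFDerivAt_fderiv_fderiv_uncurry hr f hx) hπ).clm_apply hρ
  have h₃ := HasStrictFDerivAt.comp (f := ρ) (f, x, v) (hasStrictFDerivAt_norm_sq v) hρ
  have hψ := h₁.prodMk (h₂.prodMk h₃)
  obtain ⟨U, hU, hUg⟩ := hψ.exists_isLipschitzGraph (c := (0, 0, 1)) (by
    rintro ⟨α, β, s⟩
    obtain ⟨g, hg, hg'⟩ := exists_fderiv_eq_and_fderiv_fderiv_eq (r := r) hx hv1 α β
    -- The function `g` supplies `α` and `β`. Moving `v` by `(s / 2) v` changes `|v|²` by `s` to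
    -- first order and leaves the second equation alone, because `d²f(x)v = 0`.
    refine ⟨(g, 0, (s / 2) • v), ?_⟩
    simp [π, ρ, hg, hg', hv0, hv1, mul_div_cancel₀])
  refine ⟨U ∩ {p | p.2.1 ∈ openUnitBall n}, Filter.inter_mem hU ?_, ?_⟩
  · exact (Metric.isOpen_ball.preimage (continuous_fst.comp continuous_snd)).mem_nhds hx
  · convert hUg.mono ?_ using 1
    · simp [finrank_dual_euclideanSpace]
      ring
    · rintro q ⟨⟨hqU, -⟩, -, hq⟩
      exact ⟨hqU, hq⟩

theorem isRectifiable_one_nonMorse (hr : 3 ≤ r) : IsRectifiable 1 (nonMorse n r) := by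
  rw [nonMorse_eq_image_fst]
  exact isRectifiable_one_image_fst fun p hp => exists_isLipschitzGraph_degenerateTriples hr hp

end CrBall

theorem theorem1p1 (n r : ℕ) :
    (2 ≤ r →
      (∃ K : ℕ → Set (CrBall n r),
        (∀ k, IsClosed (K k) ∧ interior (K k) = ∅) ∧ nonMorse n r = ⋃ k, K k) ∧
      IsHaarNull (nonMorse n r) ∧
      IsAronszajnNull (nonMorse n r)) ∧
    (3 ≤ r → ∃ d : ℕ, 0 < d ∧ IsRectifiable d (nonMorse n r)) :=
  ⟨fun hr => ⟨CrBall.nonMorse_eq_iUnion_isClosed hr, CrBall.isHaarNull_nonMorse hr,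
    CrBall.isAronszajnNull_nonMorse hr⟩,
    fun hr => ⟨1, one_pos, CrBall.isRectifiable_one_nonMorse hr⟩⟩
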